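/- **Conventions.** Let $K$ be a field and $G$ a finite abelian group. A *Brauer graph* $(\Delta,\mathfrak o,m)$ is a finite graph (loops and multiple edges allowed, not necessarily connected) with at least one edge and without isolated vertices, together with a cyclic ordering $\mathfrak o$ of the edges at each vertex and a multiplicity function $m$ from the vertices to the positive integers. A loop is listed twice at its vertex (as two half-edges with their own successors), and counts twice in the valency $\operatorname{val}(\mu)$; in all pairs $(i,\mu)$ below a loop at $\mu$ accordingly gives two pairs. An edge $i$ is *truncated* at its endpoint $\mu$ if $\operatorname{val}(\mu)=1=m(\mu)$. A *quantized* Brauer graph $(\Delta,\mathfrak o,m,q)$ has in addition a nonzero scalar $q_{i,\mu}\in K$ for each edge $i$ not truncated at either of its endpoints and each endpoint $\mu$ of $i$. The quiver $\mathcal Q_\Delta$ has a vertex $v_i$ for each edge $i$ and an arrow $v_i\to v_j$ whenever $j$ is the successor of $i$ at $\mu$ and $i$ is not truncated at $\mu$; moreover an edge truncated at both endpoints gives a loop $x$. If $i$ is not truncated at $\mu$, let $C_{i,\mu}=a_1\cdots a_{\operatorname{val}(\mu)}$ be the cycle of successive arrows around $\mu$ that starts at $v_i$ (paths are written from left to right).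 The *Brauer graph algebra* is $\mathcal A_\Delta=K\mathcal Q_\Delta/I_\Delta$, where $I_\Delta$ is the ideal generated by: $q_{i,\mu}C_{i,\mu}^{m(\mu)}-q_{i,\nu}C_{i,\nu}^{m(\nu)}$ for each edge $i$ with endpoints $\mu,\nu$ that is truncated at neither; $C_{i,\nu}^{m(\nu)}b_1$ for each edge $i$ truncated at one endpoint but not at the other endpoint $\nu$, with $b_1$ the first arrow of $C_{i,\nu}$; all paths $ab$ of length two, $a$ and $b$ being arrows given by successors, in which $b$ is not the arrow following $a$ in the cyclic ordering (that is, $ab$ is not a subpath of a power of some $C_{i,\mu}$); and $x^2$ for each edge truncated at both endpoints. A *weight function* is a map $W^*:(\mathcal Q_\Delta)_1\to G$, extended to paths by $W^*(a_1\cdots a_n)=W^*(a_1)\cdots W^*(a_n)$; an element of $K\mathcal Q_\Delta$ is *homogeneous* if all paths occurring in it have the same weight. The covering quiver $\mathcal Q_{W^*}$ has vertices $v_g$ and, for each arrow $a:v\to w$ and each $g\in G$, an arrow $a_g:v_g\to w_{gW^*(a)}$; let $\pi$ be the linear map given by forgetting the indices in $G$. The covering algebra is $(\mathcal A_\Delta)_{W^*}=K\mathcal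 Q_{W^*}/I_{W^*}$, where $I_{W^*}$ is the ideal generated by all linear combinations $r$ of paths with a common start and a common end such that $\pi(r)\in I_\Delta$. A *successor weighting* $W$ assigns an element $W(i,j)\in G$ to each pair of an edge $i$ and its successor $j$ at a vertex $\mu$. Let $\omega_\mu$ be the product of the $W(i,j)$ over all such pairs at $\mu$, $\operatorname{ord}(\mu)$ its order and $H_\mu=\langle\omega_\mu\rangle$. It is a *Brauer weighting* if $\operatorname{ord}(\mu)\mid m(\mu)$ for all $\mu$. The quantized Brauer covering graph $\Delta_W$ of a Brauer weighting has edges $i_g$ ($i$ an edge of $\Delta$, $g\in G$) and vertices $\mu_{[i,H_\mu g]}$, for the classes $[i,H_\mu g]$ of the equivalence relation generated by $(i,H_\mu g)\sim(j,H_\mu gW(i,j))$ for $j$ the successor of $i$ at $\mu$; the edge $i_g$ is incident with $\mu_{[i,H_\mu g]}$ for each endpoint $\mu$ of $i$, its successor there is $j_{gW(i,j)}$, the multiplicity of $\mu_d$ is $m(\mu)/\operatorname{ord}(\mu)$, and $q_W(i_g,\mu_d)=q_{i,\mu}$. The weight function *induced* by $W$ is $W^*(a)=W(i,j)$ for the arrow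 $a:v_i\to v_j$ given by the successor $j$ of $i$ at $\mu$, and $W^*(x)=\mathrm{id}_G$ for the loop $x$ of an edge truncated at both endpoints. **Theorem.** Let $(\Delta,\mathfrak o,m,q)$ be a quantized Brauer graph over $K$ and $G$ a finite abelian group. 1. Let $W$ be a Brauer weighting of $\Delta$ with values in $G$ and $W^*$ the induced weight function. Then $I_\Delta$ is generated by homogeneous elements, there is an isomorphism of $K$-algebras $(\mathcal A_\Delta)_{W^*}\cong\mathcal A_{\Delta_W}$, and $W^*(C_{i,\mu}^{m(\mu)})=\mathrm{id}_G$ for every edge $i$ and every endpoint $\mu$ of $i$ at which $i$ is not truncated. 2. Let $W^*:(\mathcal Q_\Delta)_1\to G$ be a weight function such that $I_\Delta$ is generated by homogeneous elements and $W^*(C_{i,\mu}^{m(\mu)})=\mathrm{id}_G=W^*(C_{i,\nu}^{m(\nu)})$ for each edge $i$ that is not truncated at either of its endpoints $\mu$ and $\nu$. Suppose in addition, for the degenerate components of $\Delta$ in which no such edge exists, that $W^*(C_{i,\mu}^{m(\mu)})=\mathrm{id}_G$ whenever $i$ is not truncated at $\mu$ and every edge at $\mu$ is truncated at its other endpoint,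 and that $W^*(x)=\mathrm{id}_G$ for the loop $x$ of each edge truncated at both endpoints. Then there is a Brauer weighting $W$ of $\Delta$ whose induced weight function is $W^*$ and such that $(\mathcal A_\Delta)_{W^*}\cong\mathcal A_{\Delta_W}$ as $K$-algebras. 3. Let $W^*:(\mathcal Q_\Delta)_1\to G$ be a weight function such that $I_\Delta$ is generated by homogeneous elements and $W^*(C_{i,\mu}^{m(\mu)})\neq\mathrm{id}_G$ for some edge $i$ and some endpoint $\mu$ of $i$ at which $i$ is not truncated. Then $(\mathcal A_\Delta)_{W^*}$ is not isomorphic, as a $K$-algebra, to the Brauer graph algebra of any quantized Brauer graph over $K$. -/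

import Mathlib

/-! ## Path algebras of finite quivers -/

section PathAlgebra

/-- The path algebra `K Q` of a quiver `Q` with finite vertex set `V`. The component `x a b` is
the part of `x` supported on the paths from `a` to `b`. Paths are composed from left to right. -/
def PathAlgebra (K : Type*) (V : Type*) [Field K] [Quiver V] : Type _ :=
  ∀ a b : V, Quiver.Path a b →₀ K

variable {K : Type*} {V : Type*} [Field K] [Quiver V]

/-- The bilinear extension of the composition of paths. -/
noncomputable def pathComp (K : Type*) {V : Type*} [Field K] [Quiver V] (a b c : V) :
    (Quiver.Path a b →₀ K) →ₗ[K] (Quiver.Path b c →₀ K) →ₗ[K] (Quiver.Path a c →₀ K) :=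
  Finsupp.linearCombination K fun p : Quiver.Path a b => Finsupp.lmapDomain K K fun q => p.comp q

theorem pathComp_single (a b c : V) (p : Quiver.Path a b) (q : Quiver.Path b c) (x y : K) :
    pathComp K a b c (Finsupp.single p x) (Finsupp.single q y)
      = Finsupp.single (p.comp q) (x * y) := by
  simp [pathComp, Finsupp.mapDomain_single]

theorem pathComp_assoc (a b c d : V) (x : Quiver.Path a b →₀ K) (y : Quiver.Path b c →₀ K)
    (z : Quiver.Path c d →₀ K) :
    pathComp K a c d (pathComp K a b c x y) z = pathComp K a b d x (pathComp K b c d y z) := by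
  induction x using Finsupp.induction_linear with
  | zero => simp
  | add x x' hx hx' => simp [hx, hx']
  | single p r =>
    induction y using Finsupp.induction_linear with
    | zero => simp
    | add y y' hy hy' => simp [hy, hy']
    | single q s =>
      induction z using Finsupp.induction_linear with
      | zero => simp
      | add z z' hz hz' => simp [hz, hz']
      | single t u => simp only [pathComp_single, Quiver.Path.comp_assoc, mul_assoc]

theorem nil_pathComp (a b : V) (y : Quiver.Path a b →₀ K) :
    pathComp K a a b (Finsupp.single Quiver.Path.nil 1) y = y := by
  induction y using Finsupp.induction_linear with
  | zero => simp
  | add y y' hy hy' => simp [hy, hy']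
  | single q s => simp [pathComp_single]

theorem pathComp_nil (a b : V) (y : Quiver.Path a b →₀ K) :
    pathComp K a b b y (Finsupp.single Quiver.Path.nil 1) = y := by
  induction y using Finsupp.induction_linear with
  | zero => simp
  | add y y' hy hy' => simp [hy, hy']
  | single q s => simp [pathComp_single]

namespace PathAlgebra

noncomputable instance : AddCommGroup (PathAlgebra K V) :=
  inferInstanceAs (AddCommGroup (∀ a b : V, Quiver.Path a b →₀ K))

noncomputable instance : Module K (PathAlgebra K V) :=
  inferInstanceAs (Module K (∀ a b : V, Quiver.Path a b →₀ K))

@[ext] theorem ext {x y : PathAlgebra K V} (h : ∀ a b, x a b = y a b) : x = y :=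
  funext fun a => funext fun b => h a b

@[simp] theorem add_apply (x y : PathAlgebra K V) (a b : V) : (x + y) a b = x a b + y a b := rfl

@[simp] theorem zero_apply (a b : V) : (0 : PathAlgebra K V) a b = 0 := rfl

@[simp] theorem smul_apply (r : K) (x : PathAlgebra K V) (a b : V) : (r • x) a b = r • x a b := rfl

open Classical in
/-- The element of the path algebra with the component `f` at `(a, b)` and zero elsewhere; these
are the uniform elements, that is, linear combinations of paths with common start `a` and common
end `b`. -/
noncomputable def uniform (a b : V) (f : Quiver.Path a b →₀ K) : PathAlgebra K V :=
  Pi.single a (Pi.single b f : ∀ b' : V, Quiver.Path a b' →₀ K)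

/-- A path, as an element of the path algebra. -/
noncomputable def ofPath (K : Type*) {V : Type*} [Field K] [Quiver V] {a b : V}
    (p : Quiver.Path a b) : PathAlgebra K V :=
  uniform a b (Finsupp.single p 1)

open Classical in
noncomputable instance : One (PathAlgebra K V) :=
  ⟨fun a => Pi.single a (Finsupp.single Quiver.Path.nil 1)⟩

open Classical in
theorem one_apply (a : V) : (1 : PathAlgebra K V) a
    = (Pi.single a (Finsupp.single Quiver.Path.nil 1) : ∀ b : V, Quiver.Path a b →₀ K) := rfl

variable [Fintype V]

noncomputable instance : Mul (PathAlgebra K V) :=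
  ⟨fun x y a c => ∑ b, pathComp K a b c (x a b) (y b c)⟩

theorem mul_apply (x y : PathAlgebra K V) (a c : V) :
    (x * y) a c = ∑ b, pathComp K a b c (x a b) (y b c) := rfl

noncomputable instance : Ring (PathAlgebra K V) :=
  { (inferInstance : AddCommGroup (PathAlgebra K V)) with
    mul := (· * ·)
    one := 1
    mul_assoc := fun x y z => by
      ext1 a d
      simp only [mul_apply, map_sum, LinearMap.sum_apply, pathComp_assoc]
      rw [Finset.sum_comm]
    one_mul := fun x => by
      classical
      ext1 a b
      rw [mul_apply, Finset.sum_eq_single a]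
      · rw [one_apply, Pi.single_eq_same, nil_pathComp]
      · intro c _ hc
        rw [one_apply, Pi.single_eq_of_ne hc]
        simp
      · simp
    mul_one := fun x => by
      classical
      ext1 a b
      rw [mul_apply, Finset.sum_eq_single b]
      · rw [one_apply, Pi.single_eq_same, pathComp_nil]
      · intro c _ hc
        rw [one_apply, Pi.single_eq_of_ne hc.symm]
        simp
      · simp
    zero_mul := fun x => by ext1 a b; simp [mul_apply]
    mul_zero := fun x => by ext1 a b; simp [mul_apply]
    left_distrib := fun x y z => by ext1 a b; simp [mul_apply, Finset.sum_add_distrib]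
    right_distrib := fun x y z => by ext1 a b; simp [mul_apply, Finset.sum_add_distrib] }

noncomputable instance : Algebra K (PathAlgebra K V) :=
  Algebra.ofModule
    (fun r x y => by ext1 a b; simp [mul_apply, Finset.smul_sum])
    (fun r x y => by ext1 a b; simp [mul_apply, Finset.smul_sum])

/-- The quotient algebra `K Q / I`. -/
abbrev QuotientAlgebra (I : TwoSidedIdeal (PathAlgebra K V)) : Type _ := I.ringCon.Quotient

end PathAlgebra

end PathAlgebra

/-! ## Weight functions and coverings of quivers with relations -/

section Covering

/-- A weight function on the arrows of a quiver with values in `G`. -/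
abbrev WeightFunction (V G : Type*) [Quiver V] := ∀ ⦃a b : V⦄, (a ⟶ b) → G

/-- The weight `W(a₁) W(a₂) ⋯ W(aₙ)` of the path `a₁ a₂ ⋯ aₙ`. -/
def pathWeight {V G : Type*} [Quiver V] [Monoid G] (w : WeightFunction V G) {a b : V}
    (p : Quiver.Path a b) : G :=
  p.weight fun {_ _} e => w e

/-- An element of the path algebra is weight homogeneous if all paths occurring in it have the
same weight. -/
def IsWeightHomogeneous {K V G : Type*} [Field K] [Quiver V] [Monoid G] (w : WeightFunction V G)
    (x : PathAlgebra K V) : Prop :=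
  ∃ g : G, ∀ (a b : V), ∀ p ∈ (x a b).support, pathWeight w p = g

/-- The ideal `I` can be generated by weight homogeneous elements. -/
def IsGeneratedByHomogeneous {K V G : Type*} [Field K] [Quiver V] [Fintype V] [Monoid G]
    (w : WeightFunction V G) (I : TwoSidedIdeal (PathAlgebra K V)) : Prop :=
  ∃ S : Set (PathAlgebra K V), (∀ x ∈ S, IsWeightHomogeneous w x) ∧ I = TwoSidedIdeal.span S

/-- The vertices `v_g` of the covering quiver `Q_w` of a quiver with a weight function `w`. -/
def CoveringQuiver {V G : Type*} [Quiver V] (_w : WeightFunction V G) : Type _ := V × G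

namespace CoveringQuiver

variable {V G : Type*} [Quiver V] {w : WeightFunction V G}

instance [Fintype V] [Fintype G] : Fintype (CoveringQuiver w) := inferInstanceAs (Fintype (V × G))

/-- For every arrow `a : u ⟶ v` and every `g` there is one arrow `a_g : u_g ⟶ v_{g w(a)}`. -/
instance [Mul G] : Quiver (CoveringQuiver w) where
  Hom x y := {a : x.1 ⟶ y.1 // y.2 = x.2 * w a}

/-- The projection `v_g ↦ v`, `a_g ↦ a` of the covering quiver onto the quiver. -/
def proj [Mul G] (w : WeightFunction V G) : CoveringQuiver w ⥤q V where
  obj x := x.1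
  map a := a.1

/-- The ideal of the covering quiver that is obtained from an ideal `I` by lifting relations: it
is generated by the linear combinations of paths with common start and common end that are mapped
into `I` by the projection of the covering quiver. -/
noncomputable def ideal {K : Type*} [Field K] [Fintype V] [Fintype G] [Mul G]
    (w : WeightFunction V G) (I : TwoSidedIdeal (PathAlgebra K V)) :
    TwoSidedIdeal (PathAlgebra K (CoveringQuiver w)) :=
  TwoSidedIdeal.span {x | ∃ (a b : CoveringQuiver w) (f : Quiver.Path a b →₀ K),
    x = PathAlgebra.uniform a b f ∧
      PathAlgebra.uniform ((proj w).obj a) ((proj w).obj b)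
        (f.mapDomain fun p => (proj w).mapPath p) ∈ I}

end CoveringQuiver

/-- The covering algebra of `K Q / I` associated to a weight function `w`. -/
abbrev CoveringAlgebra {K V G : Type*} [Field K] [Quiver V] [Fintype V] [Fintype G] [Mul G]
    (w : WeightFunction V G) (I : TwoSidedIdeal (PathAlgebra K V)) : Type _ :=
  PathAlgebra.QuotientAlgebra (CoveringQuiver.ideal w I)

end Covering

/-! ## Brauer graphs -/

universe u v w x

/-- A Brauer graph: a finite graph (not necessarily connected) with at least one edge and without
isolated vertices, with a cyclic ordering of the edges at each vertex and a multiplicity function.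
Loops and multiple edges are allowed. The graph is described by its vertices `V`, its edges `E`
and its half-edges `H`. Each edge consists of two half-edges, which are interchanged by `opp`; so
a half-edge is an edge together with one of its endpoints `vert`, and a loop occurs twice at its
vertex. The successor of the half-edge `h` at the vertex `vert h` is `succ h`; the orbits of `succ`
are the sets of half-edges at the vertices. -/
structure BrauerGraph : Type (u + 1) where
  V : Type u
  E : Type u
  H : Type u
  [fintypeE : Fintype E]
  [fintypeH : Fintype H]
  [nonemptyH : Nonempty H]
  vert : H → V
  edge : H → E
  opp : H → H
  succ : Equiv.Perm H
  vert_surjective : Function.Surjective vert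
  edge_surjective : Function.Surjective edge
  opp_opp : ∀ h, opp (opp h) = h
  opp_ne : ∀ h, opp h ≠ h
  edge_eq_iff : ∀ h k, edge h = edge k ↔ k = h ∨ k = opp h
  vert_eq_iff : ∀ h k, vert h = vert k ↔ succ.SameCycle h k
  mult : V → ℕ
  mult_pos : ∀ μ, 0 < mult μ

namespace BrauerGraph

instance (Γ : BrauerGraph.{u}) : Fintype Γ.E := Γ.fintypeE
instance (Γ : BrauerGraph.{u}) : Fintype Γ.H := Γ.fintypeH
instance (Γ : BrauerGraph.{u}) : Nonempty Γ.H := Γ.nonemptyH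

variable (Γ : BrauerGraph.{u})

theorem vert_succ (h : Γ.H) : Γ.vert (Γ.succ h) = Γ.vert h :=
  ((Γ.vert_eq_iff h (Γ.succ h)).2 ⟨1, by simp⟩).symm

/-- The valency of a vertex; loops count twice. -/
noncomputable def val (μ : Γ.V) : ℕ := Nat.card {h : Γ.H // Γ.vert h = μ}

/-- The edge of `h` is truncated at the endpoint `vert h`. -/
def IsTruncated (h : Γ.H) : Prop := Γ.val (Γ.vert h) = 1 ∧ Γ.mult (Γ.vert h) = 1

theorem isTruncated_succ (h : Γ.H) : Γ.IsTruncated (Γ.succ h) ↔ Γ.IsTruncated h := by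
  simp only [IsTruncated, vert_succ]

/-- The pairs of an edge and an endpoint at which it is not truncated, with half-edges for pairs. -/
abbrev NonTrunc : Type u := {h : Γ.H // ¬ Γ.IsTruncated h}

/-- The successor, on the half-edges that are not truncated. -/
def next (h : Γ.NonTrunc) : Γ.NonTrunc := ⟨Γ.succ h, fun hs => h.2 ((Γ.isTruncated_succ _).1 hs)⟩

/-- The arrows of the quiver of a Brauer graph: one for each half-edge that is not truncated, and
the loop `x` of the quiver of an edge that is truncated at both of its endpoints. -/
inductive Arrow (Γ : BrauerGraph.{u}) : Type u
  | ofSucc (h : Γ.NonTrunc) : Arrow Γ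
  | loop (i : Γ.E) (hi : ∀ h, Γ.edge h = i → Γ.IsTruncated h) : Arrow Γ

/-- The start of an arrow. -/
def Arrow.source {Γ : BrauerGraph.{u}} : Γ.Arrow → Γ.E
  | ofSucc h => Γ.edge h
  | loop i _ => i

/-- The end of an arrow. -/
def Arrow.target {Γ : BrauerGraph.{u}} : Γ.Arrow → Γ.E
  | ofSucc h => Γ.edge (Γ.succ h)
  | loop i _ => i

/-- The vertices `v_i` of the quiver `Q_Γ` of a Brauer graph, one for each edge `i`. -/
def QuiverVertex : Type u := Γ.E

instance : Fintype Γ.QuiverVertex := inferInstanceAs (Fintype Γ.E)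

instance : Quiver Γ.QuiverVertex where
  Hom i j := {a : Γ.Arrow // a.source = i ∧ a.target = j}

/-- The source of an arrow, as a vertex of the quiver. -/
def Arrow.src {Γ : BrauerGraph.{u}} (a : Γ.Arrow) : Γ.QuiverVertex := a.source

/-- The target of an arrow, as a vertex of the quiver. -/
def Arrow.tgt {Γ : BrauerGraph.{u}} (a : Γ.Arrow) : Γ.QuiverVertex := a.target

/-- An arrow, as a morphism of the quiver. -/
def Arrow.hom {Γ : BrauerGraph.{u}} (a : Γ.Arrow) : a.src ⟶ a.tgt := ⟨a, rfl, rfl⟩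

/-- An arrow, as an element of the path algebra. -/
noncomputable def Arrow.elt {Γ : BrauerGraph.{u}} (K : Type v) [Field K] (a : Γ.Arrow) :
    PathAlgebra K Γ.QuiverVertex :=
  PathAlgebra.ofPath K a.hom.toPath

/-- The arrows `a₁, …, a_{val μ}` of the cycle `C_{i, μ}`, for an edge `i` that is not truncated
at its endpoint `μ`, the pair being given as a half-edge. -/
noncomputable def cycleArrows (h : Γ.NonTrunc) : List Γ.Arrow :=
  (List.range (Γ.val (Γ.vert h))).map fun r => Arrow.ofSucc (Γ.next^[r] h)

/-- The cycle `C_{i, μ} = a₁ a₂ ⋯ a_{val μ}` in the path algebra. -/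
noncomputable def cycle (K : Type v) [Field K] (h : Γ.NonTrunc) : PathAlgebra K Γ.QuiverVertex :=
  ((Γ.cycleArrows h).map fun a => a.elt K).prod

/-- The weight of the path `C_{i, μ} ^ m(μ)`. -/
noncomputable def cyclePowWeight {G : Type w} [Monoid G] (ω : WeightFunction Γ.QuiverVertex G)
    (h : Γ.NonTrunc) : G :=
  ((Γ.cycleArrows h).map fun a => ω a.hom).prod ^ Γ.mult (Γ.vert h)

end BrauerGraph

/-- A quantized Brauer graph over `K`: for each edge `i` that is not truncated at either of its
endpoints, and each endpoint `μ` of `i`, a nonzero scalar `q_{i, μ}`. -/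
structure QuantizedBrauerGraph (K : Type v) [Field K] extends BrauerGraph.{u} where
  q : {h : H // ¬ toBrauerGraph.IsTruncated h ∧ ¬ toBrauerGraph.IsTruncated (opp h)} → Kˣ

namespace QuantizedBrauerGraph

variable {K : Type v} [Field K]

/-- The Brauer graph relations. -/
inductive Relation (Γ : QuantizedBrauerGraph.{u, v} K) :
    PathAlgebra K Γ.QuiverVertex → Prop
  /-- Type one: `q_{i, μ} C_{i, μ} ^ m(μ) - q_{i, ν} C_{i, ν} ^ m(ν)`, for an edge `i` that is not
  truncated at either of its endpoints `μ`, `ν`. -/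
  | one (h : Γ.H) (hμ : ¬ Γ.IsTruncated h) (hν : ¬ Γ.IsTruncated (Γ.opp h)) :
      Relation Γ
        ((Γ.q ⟨h, hμ, hν⟩ : K) • Γ.cycle K ⟨h, hμ⟩ ^ Γ.mult (Γ.vert h) -
          (Γ.q ⟨Γ.opp h, hν, by rwa [Γ.opp_opp]⟩ : K) •
            Γ.cycle K ⟨Γ.opp h, hν⟩ ^ Γ.mult (Γ.vert (Γ.opp h)))
  /-- Type two: `C_{i, ν} ^ m(ν) b₁`, for an edge `i` that is truncated at one of its endpoints and
  not truncated at the other endpoint `ν`, where `b₁` is the first arrow of `C_{i, ν}`. -/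
  | two (h : Γ.NonTrunc) (hμ : Γ.IsTruncated (Γ.opp h)) :
      Relation Γ (Γ.cycle K h ^ Γ.mult (Γ.vert h) * (BrauerGraph.Arrow.ofSucc h).elt K)
  /-- Type three: the paths `a b` of length two that are not subpaths of a power of a cycle
  `C_{i, μ}`, that is, `b` is not the arrow that follows `a` in the cyclic ordering. -/
  | three (h k : Γ.NonTrunc) (hk : Γ.edge (Γ.succ h) = Γ.edge k) (hne : k ≠ Γ.next h) :
      Relation Γ ((BrauerGraph.Arrow.ofSucc h).elt K * (BrauerGraph.Arrow.ofSucc k).elt K)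
  /-- The relation `x ^ 2` for an edge that is truncated at both of its endpoints. -/
  | square (i : Γ.E) (hi : ∀ h, Γ.edge h = i → Γ.IsTruncated h) :
      Relation Γ ((BrauerGraph.Arrow.loop i hi).elt K ^ 2)

/-- The ideal generated by the Brauer graph relations. -/
noncomputable def ideal (Γ : QuantizedBrauerGraph.{u, v} K) :
    TwoSidedIdeal (PathAlgebra K Γ.QuiverVertex) :=
  TwoSidedIdeal.span {x | Γ.Relation x}

/-- The Brauer graph algebra `A_Γ = K Q_Γ / I_Γ`. -/
abbrev Alg (Γ : QuantizedBrauerGraph.{u, v} K) : Type _ := PathAlgebra.QuotientAlgebra Γ.ideal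

end QuantizedBrauerGraph

/-! ## Brauer weightings and Brauer covering graphs -/

namespace BrauerGraph

variable {G : Type w} [CommGroup G] (Δ : BrauerGraph.{u})

/-- A successor weighting: `W h` is the weight `W(i, j)` of the pair consisting of the edge `i` of
`h` and its successor `j` at the vertex of `h`. -/
abbrev SuccessorWeighting (G : Type w) : Type _ := Δ.H → G

variable {Δ}

open Classical in
/-- The element `ω_μ`, the product of the weights `W(i, j)` over all pairs of an edge `i` and its
successor `j` at `μ`. The order of `μ` is `orderOf (vertexWeight W μ)`. -/
noncomputable def vertexWeight (W : Δ.SuccessorWeighting G) (μ : Δ.V) : G :=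
  ∏ h : Δ.H with Δ.vert h = μ, W h

/-- Brauer weightings: the order of `μ` divides `m(μ)`, for each vertex `μ`. -/
def IsBrauerWeighting (W : Δ.SuccessorWeighting G) : Prop :=
  ∀ μ, orderOf (vertexWeight W μ) ∣ Δ.mult μ

/-- The weight function on the arrows of the quiver that is induced by a successor weighting. An
edge that is truncated at both of its endpoints is its own successor at each of them, and Brauer
weightings have the value `1` there; so the corresponding loop has weight `1`. -/
def arrowWeight (W : Δ.SuccessorWeighting G) : WeightFunction Δ.QuiverVertex G :=
  fun _ _ a => match a.1 with
    | Arrow.ofSucc h => W h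
    | Arrow.loop _ _ => 1

/-- The subgroup `H_μ` generated by `ω_μ`. -/
noncomputable abbrev vertexSubgroup (W : Δ.SuccessorWeighting G) (μ : Δ.V) : Subgroup G :=
  Subgroup.zpowers (vertexWeight W μ)

/-- The relation `(i, H_μ g) ∼ (j, H_μ g W(i, j))`, where `j` is the successor of `i` at `μ`. -/
def coverVertexRel (W : Δ.SuccessorWeighting G)
    (x y : Σ h : Δ.H, G ⧸ vertexSubgroup W (Δ.vert h)) : Prop :=
  ∃ (h : Δ.H) (g : G), x = ⟨h, (g : G ⧸ _)⟩ ∧ y = ⟨Δ.succ h, ((g * W h : G) : G ⧸ _)⟩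

/-- The vertices `μ_{[i, H_μ g]}` of the covering graph: the classes of the equivalence relation
generated by `coverVertexRel`. -/
def CoverVertex (W : Δ.SuccessorWeighting G) : Type _ := Quot (coverVertexRel W)

/-- The endpoint of `i_g` that is given by the half-edge `h` of `i`. -/
noncomputable def coverVert (W : Δ.SuccessorWeighting G) (x : Δ.H × G) : CoverVertex W :=
  Quot.mk _ ⟨x.1, (x.2 : G ⧸ vertexSubgroup W (Δ.vert x.1))⟩

/-- The vertex `μ` below a vertex `μ_d` of the covering graph. -/
noncomputable def CoverVertex.base {W : Δ.SuccessorWeighting G} (d : CoverVertex W) : Δ.V :=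
  Quot.lift (fun x => Δ.vert x.1) (by
    rintro _ _ ⟨h, g, rfl, rfl⟩
    exact (Δ.vert_succ h).symm) d

/-- The successor of `i_g` is `j_{g W(i, j)}`, where `j` is the successor of `i`. -/
def coverSucc (W : Δ.SuccessorWeighting G) : Equiv.Perm (Δ.H × G) where
  toFun x := (Δ.succ x.1, x.2 * W x.1)
  invFun x := (Δ.succ.symm x.1, x.2 * (W (Δ.succ.symm x.1))⁻¹)
  left_inv x := by simp
  right_inv x := by simp

theorem coverSucc_pow (W : Δ.SuccessorWeighting G) (n : ℕ) (h : Δ.H) (g : G) :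
    (coverSucc W ^ n) (h, g)
      = ((Δ.succ ^ n) h, g * ∏ k ∈ Finset.range n, W ((Δ.succ ^ k) h)) := by
  induction n with
  | zero => simp
  | succ n ih =>
    rw [pow_succ', Equiv.Perm.mul_apply, ih, Finset.prod_range_succ, pow_succ']
    simp [coverSucc, mul_assoc]

theorem exists_pow_eq_and_prod (W : Δ.SuccessorWeighting G) (h : Δ.H) :
    ∃ n : ℕ, (Δ.succ ^ n) h = h ∧
      ∏ k ∈ Finset.range n, W ((Δ.succ ^ k) h) = vertexWeight W (Δ.vert h) := by
  classical
  have hit : ∀ k, (Δ.succ ^ k) h = Δ.succ^[k] h := fun k => by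
    rw [Equiv.Perm.iterate_eq_pow]
  have hper : h ∈ Function.periodicPts Δ.succ :=
    ⟨orderOf Δ.succ, orderOf_pos _, by
      rw [Function.IsPeriodicPt, Function.IsFixedPt, ← hit, pow_orderOf_eq_one]; rfl⟩
  refine ⟨Function.minimalPeriod Δ.succ h, ?_, ?_⟩
  · rw [hit]; exact Function.isPeriodicPt_minimalPeriod _ _
  · unfold vertexWeight
    refine Finset.prod_bij (fun k _ => (Δ.succ ^ k) h) ?_ ?_ ?_ ?_
    · intro k _
      simp only [Finset.mem_filter, Finset.mem_univ, true_and]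
      exact ((Δ.vert_eq_iff _ _).2 ⟨k, by simp⟩).symm
    · intro a ha b hb hab
      rw [hit, hit] at hab
      exact Function.iterate_injOn_Iio_minimalPeriod (by simpa using ha) (by simpa using hb) hab
    · intro k hk
      simp only [Finset.mem_filter, Finset.mem_univ, true_and] at hk
      obtain ⟨n, hn⟩ := ((Δ.vert_eq_iff _ _).1 hk.symm).exists_nat_pow_eq
      refine ⟨n % Function.minimalPeriod Δ.succ h, ?_, ?_⟩
      · exact Finset.mem_range.2
          (Nat.mod_lt _ (Function.minimalPeriod_pos_of_mem_periodicPts hper))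
      · rw [hit, Function.iterate_mod_minimalPeriod_eq, ← hit, hn]
    · intros; rfl

theorem sameCycle_coverSucc_of_mem (W : Δ.SuccessorWeighting G) (h : Δ.H) (g c : G)
    (hc : c ∈ vertexSubgroup W (Δ.vert h)) :
    (coverSucc W).SameCycle (h, g) (h, g * c) := by
  obtain ⟨n, hn, hp⟩ := exists_pow_eq_and_prod W h
  have key : ∀ g, (coverSucc W ^ n) (h, g) = (h, g * vertexWeight W (Δ.vert h)) := fun g => by
    rw [coverSucc_pow, hn, hp]
  have hnat : ∀ (t : ℕ) g, (coverSucc W).SameCycle (h, g) (h, g * vertexWeight W (Δ.vert h) ^ t) := by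
    intro t
    induction t with
    | zero => intro g; simpa using Equiv.Perm.SameCycle.refl _ _
    | succ t ih =>
      intro g
      refine (ih g).trans ⟨n, ?_⟩
      rw [zpow_natCast, key, pow_succ, mul_assoc]
  obtain ⟨z, rfl⟩ := Subgroup.mem_zpowers_iff.1 hc
  rcases Int.eq_nat_or_neg z with ⟨t, rfl | rfl⟩
  · simpa using hnat t g
  · have := hnat t (g * vertexWeight W (Δ.vert h) ^ (-(t : ℤ)))
    simpa using this.symm

theorem coverVert_eq_iff (W : Δ.SuccessorWeighting G) (x y : Δ.H × G) :
    coverVert W x = coverVert W y ↔ (coverSucc W).SameCycle x y := by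
  constructor
  · intro hxy
    let f : CoverVertex W → Quotient (Equiv.Perm.SameCycle.setoid (coverSucc W)) :=
      Quot.lift
        (fun z => Quotient.liftOn' z.2 (fun g => Quotient.mk _ (z.1, g)) (by
          intro a b hab
          have hab' := QuotientGroup.leftRel_apply.1 hab
          refine Quotient.sound ?_
          have := sameCycle_coverSucc_of_mem W z.1 a _ hab'
          rwa [mul_inv_cancel_left] at this))
        (by
          rintro _ _ ⟨h, g, rfl, rfl⟩
          refine Quotient.sound ?_
          exact ⟨1, by simp [coverSucc]⟩)
    have := congrArg f hxy
    exact Quotient.exact this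
  · have hstep : ∀ z, coverVert W (coverSucc W z) = coverVert W z := fun z =>
      (Quot.sound ⟨z.1, z.2, rfl, rfl⟩).symm
    have hnat : ∀ (n : ℕ) z, coverVert W ((coverSucc W ^ n) z) = coverVert W z := by
      intro n
      induction n with
      | zero => intro z; simp
      | succ n ih => intro z; rw [pow_succ', Equiv.Perm.mul_apply, hstep, ih]
    rintro ⟨z, rfl⟩
    rcases Int.eq_nat_or_neg z with ⟨t, rfl | rfl⟩
    · rw [zpow_natCast, hnat]
    · rw [← hnat t ((coverSucc W ^ (-(t : ℤ))) x), ← Equiv.Perm.mul_apply]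
      simp

theorem coverVert_surjective (W : Δ.SuccessorWeighting G) :
    Function.Surjective (coverVert W) := by
  rintro ⟨h, c⟩
  induction c using QuotientGroup.induction_on with
  | H g => exact ⟨(h, g), rfl⟩

variable [Fintype G]

/-- The Brauer covering graph `Δ_W`. Its edges are the pairs `i_g`, and its multiplicity function
is `μ_d ↦ m(μ) / ord(μ)`. -/
noncomputable def cover (Δ : BrauerGraph.{u}) (W : Δ.SuccessorWeighting G)
    (hW : IsBrauerWeighting W) : BrauerGraph.{max u w} where
  V := CoverVertex W
  E := Δ.E × G
  H := Δ.H × G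
  vert := coverVert W
  edge x := (Δ.edge x.1, x.2)
  opp x := (Δ.opp x.1, x.2)
  succ := coverSucc W
  vert_surjective := coverVert_surjective W
  edge_surjective := by
    rintro ⟨i, g⟩
    obtain ⟨h, rfl⟩ := Δ.edge_surjective i
    exact ⟨(h, g), rfl⟩
  opp_opp x := by simp [Δ.opp_opp]
  opp_ne x hx := Δ.opp_ne x.1 (congrArg Prod.fst hx)
  edge_eq_iff x y := by
    rw [Prod.ext_iff, Prod.ext_iff, Prod.ext_iff]
    simp only [Δ.edge_eq_iff]
    tauto
  vert_eq_iff := coverVert_eq_iff W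
  mult d := Δ.mult d.base / orderOf (vertexWeight W d.base)
  mult_pos d := Nat.div_pos (Nat.le_of_dvd (Δ.mult_pos _) (hW _)) (orderOf_pos _)

theorem isTruncated_cover (W : Δ.SuccessorWeighting G) (hW : IsBrauerWeighting W) (h : Δ.H) (g : G)
    (ht : Δ.IsTruncated h) : (Δ.cover W hW).IsTruncated (h, g) := by
  classical
  have hsub : ∀ k, Δ.vert k = Δ.vert h → k = h := by
    intro k hk
    have := (Nat.card_eq_one_iff_unique.1 ht.1).1
    exact congrArg Subtype.val
      (Subsingleton.elim (⟨k, hk⟩ : {k // Δ.vert k = Δ.vert h}) ⟨h, rfl⟩)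
  have hord : orderOf (vertexWeight W (Δ.vert h)) = 1 :=
    Nat.dvd_one.1 (ht.2 ▸ hW (Δ.vert h))
  have hω : vertexWeight W (Δ.vert h) = W h := by
    unfold vertexWeight
    rw [show (Finset.univ.filter fun k => Δ.vert k = Δ.vert h) = {h} by
      ext k; simpa using ⟨hsub k, fun e => by rw [e]⟩]
    simp
  have hWh : W h = 1 := by rw [← hω]; exact orderOf_eq_one_iff.1 hord
  have hs : coverSucc W (h, g) = (h, g) := by
    simp [coverSucc, hWh, hsub _ (Δ.vert_succ h)]
  refine ⟨?_, ?_⟩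
  · refine Nat.card_eq_one_iff_unique.2 ⟨⟨?_⟩, ⟨⟨(h, g), rfl⟩⟩⟩
    have aux : ∀ x : Δ.H × G, coverVert W x = coverVert W (h, g) → x = (h, g) := by
      intro x hx
      obtain ⟨z, hz⟩ := ((coverVert_eq_iff W _ _).1 hx).symm
      rw [← hz]
      exact Function.IsFixedPt.perm_zpow hs z
    rintro ⟨x, hx⟩ ⟨y, hy⟩
    exact Subtype.ext ((aux x hx).trans (aux y hy).symm)
  · change Δ.mult (Δ.vert h) / orderOf (vertexWeight W (Δ.vert h)) = 1
    rw [ht.2, hord]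

end BrauerGraph

namespace QuantizedBrauerGraph

open BrauerGraph

variable {K : Type v} [Field K] {G : Type w} [CommGroup G] [Fintype G]

/-- The quantized Brauer covering graph, with `q_W (i_g, μ_d) = q_{i, μ}`. -/
noncomputable def cover (Δ : QuantizedBrauerGraph.{u, v} K)
    (W : Δ.toBrauerGraph.SuccessorWeighting G) (hW : IsBrauerWeighting W) :
    QuantizedBrauerGraph.{max u w, v} K where
  toBrauerGraph := Δ.toBrauerGraph.cover W hW
  q x := Δ.q ⟨x.1.1, fun ht => x.2.1 (isTruncated_cover W hW x.1.1 x.1.2 ht),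
    fun ht => x.2.2 (isTruncated_cover W hW (Δ.opp x.1.1) x.1.2 ht)⟩

end QuantizedBrauerGraph

/-!
Part 1 is an identification of quivers with relations. The quiver of the covering graph `Δ_W` is
the covering quiver of `Q_Δ`: an edge `i_g` is truncated at an endpoint exactly if `i` is
truncated at the endpoint below, since passing to the covering graph multiplies the valency of a
vertex by `ord(μ)` and divides its multiplicity by `ord(μ)`, so that the length `val(μ) * m(μ)` of
the path `C_{i, μ} ^ m(μ)` is the same upstairs and downstairs (`len_cover`). This gives mutually
inverse homomorphisms `toCovering` and `ofCovering` of path algebras. To compare the ideals, let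
`liftHom` be the homomorphism that maps a path of `Q_Δ` to the sum of its lifts. A relation of
`Δ_W` at `i_g` is `e * liftHom r` for a relation `r` of `Δ` at `i` and the idempotent `e` of
`i_g`, and all relations of `Δ` lift in this way (`exists_relation_of_cover`,
`exists_relation_cover`). Since the paths `C_{i, μ} ^ m(μ)` have weight `ω_μ ^ m(μ) = 1`, the
relations are homogeneous, and so their lifts belong to the ideal of the covering algebra
(`liftHom_mem_ideal`). Conversely, every generator of that ideal is recovered from its projection
by lifting (`vtx_mul_liftHom_mul_vtx`).

Part 2 reduces to part 1: a weight function is induced by the successor weighting that has the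
same values on the arrows and the value `1` at the truncated half-edges. At a vertex `μ`
whose edges are not truncated at `μ`, one of the hypotheses provides a path `C_{i, μ} ^ m(μ)` of
weight `1`, which means `ω_μ ^ m(μ) = 1`; at the other vertices, `ω_μ` is `1` by definition.

Part 3 rests on a property of `K`-algebras that is preserved by isomorphisms: in a Brauer graph
algebra, an element `x` such that `K x` is a right ideal is central (`commute_of_mul_mem_span`).
Arrows are nilpotent, so such an `x` is annihilated by the arrows from the right. A linear form
that is nonzero on the paths `C_{i, μ} ^ m(μ)` then shows that `x` is a combination of these paths
and of the loops of edges truncated at both endpoints, all of which are central. On the other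
hand, if `C_{i, μ} ^ m(μ)` has a nontrivial weight, then a lift of it is nonzero in the covering
algebra and spans a right ideal, but it is not a cycle, so it does not commute with the idempotent
of the vertex at which it starts (`exists_not_commute`).
-/

/-! ### The universal property of path algebras -/

namespace PathAlgebra

variable {K : Type*} {V : Type*} [Field K] [Quiver V]

theorem uniform_apply_same (a b : V) (f : Quiver.Path a b →₀ K) : uniform a b f a b = f := by
  classical
  simp [uniform]

theorem uniform_apply_of_ne {a b a' b' : V} (f : Quiver.Path a b →₀ K) (h : ¬ (a' = a ∧ b' = b)) :
    uniform a b f a' b' = 0 := by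
  classical
  unfold uniform
  by_cases ha : a' = a
  · subst ha
    rw [Pi.single_eq_same, Pi.single_eq_of_ne (by tauto)]
  · rw [Pi.single_eq_of_ne ha]
    rfl

/-- The inclusion of the component at `(a, b)` into the path algebra. -/
noncomputable def uniformHom (K : Type*) {V : Type*} [Field K] [Quiver V] (a b : V) :
    (Quiver.Path a b →₀ K) →ₗ[K] PathAlgebra K V where
  toFun := uniform a b
  map_add' f g := by
    ext1 a' b'
    by_cases h : a' = a ∧ b' = b
    · obtain ⟨rfl, rfl⟩ := h
      simp [uniform_apply_same]
    · simp [uniform_apply_of_ne _ h]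
  map_smul' r f := by
    ext1 a' b'
    by_cases h : a' = a ∧ b' = b
    · obtain ⟨rfl, rfl⟩ := h
      simp [uniform_apply_same]
    · simp [uniform_apply_of_ne _ h]

@[simp] theorem uniformHom_apply (a b : V) (f : Quiver.Path a b →₀ K) :
    uniformHom K a b f = uniform a b f := rfl

theorem uniform_single (a b : V) (p : Quiver.Path a b) (c : K) :
    uniform a b (Finsupp.single p c) = c • ofPath K p := by
  rw [ofPath, ← uniformHom_apply, ← uniformHom_apply, ← map_smul, Finsupp.smul_single, smul_eq_mul,
    mul_one]

theorem uniform_eq_sum (a b : V) (f : Quiver.Path a b →₀ K) :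
    uniform a b f = f.sum fun p c => c • ofPath K p := by
  conv_lhs => rw [← f.sum_single]
  rw [← uniformHom_apply, map_finsuppSum]
  simp only [uniformHom_apply, uniform_single]

/-- The idempotent of the path algebra given by the trivial path at a vertex. -/
noncomputable def vtx (K : Type*) {V : Type*} [Field K] [Quiver V] (a : V) : PathAlgebra K V :=
  ofPath K (Quiver.Path.nil : Quiver.Path a a)

/-- An arrow, as an element of the path algebra. -/
noncomputable def arr (K : Type*) {V : Type*} [Field K] [Quiver V] {a b : V} (e : a ⟶ b) :
    PathAlgebra K V :=
  ofPath K e.toPath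

variable [Fintype V]

theorem eq_sum_uniform (x : PathAlgebra K V) : x = ∑ a, ∑ b, uniform a b (x a b) := by
  have key : ∀ a' b' : V, (∑ a, ∑ b, uniform a b (x a b)) a' b'
      = ∑ a, ∑ b, uniform a b (x a b) a' b' := by
    intro a' b'
    let ev : PathAlgebra K V →+ (Quiver.Path a' b' →₀ K) := ⟨⟨fun x => x a' b', rfl⟩, fun _ _ => rfl⟩
    exact (map_sum ev _ _).trans (Finset.sum_congr rfl fun a _ => map_sum ev _ _)
  ext1 a' b'
  rw [key, Finset.sum_eq_single a', Finset.sum_eq_single b', uniform_apply_same]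
  · intro b _ hb
    exact uniform_apply_of_ne _ (by tauto)
  · simp
  · intro a _ ha
    exact Finset.sum_eq_zero fun b _ => uniform_apply_of_ne _ (by tauto)
  · simp

/-- The paths span the path algebra. -/
theorem induction_on {P : PathAlgebra K V → Prop} (x : PathAlgebra K V) (zero : P 0)
    (add : ∀ x y, P x → P y → P (x + y)) (smul : ∀ (c : K) x, P x → P (c • x))
    (path : ∀ (a b : V) (p : Quiver.Path a b), P (ofPath K p)) : P x := by
  rw [eq_sum_uniform x]
  refine Finset.sum_induction _ P add zero fun a _ => Finset.sum_induction _ P add zero fun b _ => ?_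
  rw [uniform_eq_sum]
  exact Finset.sum_induction _ P add zero fun p _ => smul _ _ (path a b p)

theorem uniform_mul_uniform {a b c : V} (f : Quiver.Path a b →₀ K) (g : Quiver.Path b c →₀ K) :
    uniform a b f * uniform b c g = uniform a c (pathComp K a b c f g) := by
  ext1 a' c'
  rw [mul_apply, Finset.sum_eq_single b]
  · by_cases h : a' = a ∧ c' = c
    · obtain ⟨rfl, rfl⟩ := h
      simp only [uniform_apply_same]
    · rw [uniform_apply_of_ne _ h]
      by_cases ha : a' = a
      · rw [uniform_apply_of_ne g (by tauto), map_zero]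
      · rw [uniform_apply_of_ne f (by tauto), map_zero, LinearMap.zero_apply]
  · intro b' _ hb
    rw [uniform_apply_of_ne f (by tauto), map_zero, LinearMap.zero_apply]
  · simp

theorem uniform_mul_uniform_of_ne {a b b' c : V} (hb : b ≠ b') (f : Quiver.Path a b →₀ K)
    (g : Quiver.Path b' c →₀ K) : uniform a b f * uniform b' c g = 0 := by
  ext1 a' c'
  rw [mul_apply, zero_apply]
  refine Finset.sum_eq_zero fun d _ => ?_
  by_cases hd : d = b
  · rw [uniform_apply_of_ne g (by subst hd; tauto), map_zero]
  · rw [uniform_apply_of_ne f (by tauto), map_zero, LinearMap.zero_apply]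

theorem ofPath_mul_ofPath {a b c : V} (p : Quiver.Path a b) (q : Quiver.Path b c) :
    ofPath K p * ofPath K q = ofPath K (p.comp q) := by
  rw [ofPath, ofPath, ofPath, uniform_mul_uniform, pathComp_single, mul_one]

theorem ofPath_mul_ofPath_of_ne {a b b' c : V} (hb : b ≠ b') (p : Quiver.Path a b)
    (q : Quiver.Path b' c) : ofPath K p * ofPath K q = 0 :=
  uniform_mul_uniform_of_ne hb _ _

theorem vtx_mul_ofPath {a b : V} (p : Quiver.Path a b) : vtx K a * ofPath K p = ofPath K p := by
  rw [vtx, ofPath_mul_ofPath, Quiver.Path.nil_comp]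

theorem ofPath_mul_vtx {a b : V} (p : Quiver.Path a b) : ofPath K p * vtx K b = ofPath K p := by
  rw [vtx, ofPath_mul_ofPath, Quiver.Path.comp_nil]

theorem vtx_mul_ofPath_of_ne {a b c : V} (h : c ≠ a) (p : Quiver.Path a b) :
    vtx K c * ofPath K p = 0 :=
  ofPath_mul_ofPath_of_ne h _ _

theorem ofPath_mul_vtx_of_ne {a b c : V} (h : b ≠ c) (p : Quiver.Path a b) :
    ofPath K p * vtx K c = 0 :=
  ofPath_mul_ofPath_of_ne h _ _

theorem vtx_mul_self (a : V) : vtx K a * vtx K a = vtx K a := vtx_mul_ofPath _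

theorem vtx_mul_vtx_of_ne {a b : V} (h : a ≠ b) : vtx K a * vtx K b = 0 :=
  ofPath_mul_ofPath_of_ne h _ _

theorem vtx_mul_arr {a b : V} (e : a ⟶ b) : vtx K a * arr K e = arr K e := vtx_mul_ofPath _

theorem arr_mul_vtx {a b : V} (e : a ⟶ b) : arr K e * vtx K b = arr K e := ofPath_mul_vtx _

theorem ofPath_cons {a b c : V} (p : Quiver.Path a b) (e : b ⟶ c) :
    ofPath K (p.cons e) = ofPath K p * arr K e := by
  rw [arr, ofPath_mul_ofPath]
  rfl

theorem vtx_mul_uniform {a b : V} (f : Quiver.Path a b →₀ K) :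
    vtx K a * uniform a b f = uniform a b f := by
  rw [vtx, ofPath, uniform_mul_uniform, nil_pathComp]

theorem uniform_mul_vtx {a b : V} (f : Quiver.Path a b →₀ K) :
    uniform a b f * vtx K b = uniform a b f := by
  rw [vtx, ofPath, uniform_mul_uniform, pathComp_nil]

theorem sum_vtx : ∑ a : V, vtx K a = 1 := by
  classical
  refine (eq_sum_uniform (1 : PathAlgebra K V)).symm ▸ Finset.sum_congr rfl fun a _ => ?_
  rw [Finset.sum_eq_single a]
  · rw [one_apply, Pi.single_eq_same]
    rfl
  · intro b _ hb
    rw [one_apply, Pi.single_eq_of_ne hb, ← uniformHom_apply, map_zero]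
  · simp

/-- The linear map on the path algebra with prescribed values on the paths. -/
noncomputable def linearLift (K : Type*) {V M : Type*} [Field K] [Quiver V] [Fintype V]
    [AddCommGroup M] [Module K M] (c : ∀ a b : V, Quiver.Path a b → M) :
    PathAlgebra K V →ₗ[K] M where
  toFun x := ∑ a, ∑ b, Finsupp.linearCombination K (c a b) (x a b)
  map_add' x y := by simp [Finset.sum_add_distrib]
  map_smul' r x := by simp [Finset.smul_sum]

theorem linearLift_ofPath {M : Type*} [AddCommGroup M] [Module K M]
    (c : ∀ a b : V, Quiver.Path a b → M) {a b : V} (p : Quiver.Path a b) :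
    linearLift K c (ofPath K p) = c a b p := by
  change ∑ a', ∑ b', Finsupp.linearCombination K (c a' b') (ofPath K p a' b') = _
  rw [Finset.sum_eq_single a, Finset.sum_eq_single b]
  · rw [ofPath, uniform_apply_same]
    simp
  · intro b' _ hb
    rw [ofPath, uniform_apply_of_ne _ (by tauto), map_zero]
  · simp
  · intro a' _ ha
    refine Finset.sum_eq_zero fun b' _ => ?_
    rw [ofPath, uniform_apply_of_ne _ (by tauto), map_zero]
  · simp

variable {B : Type*} [Ring B] [Algebra K B]

/-- The data from which the universal property of the path algebra of a finite quiver produces an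
algebra homomorphism to `B`: a complete family of orthogonal idempotents indexed by the vertices
and, for each arrow, an element of `B` in the corresponding Peirce component. -/
structure LiftData (V B : Type*) [Quiver V] [Fintype V] [Ring B] where
  vtx : V → B
  arr : ∀ ⦃a b : V⦄, (a ⟶ b) → B
  sum_vtx : ∑ a, vtx a = 1
  idem : ∀ a, vtx a * vtx a = vtx a
  orth : ∀ a b, a ≠ b → vtx a * vtx b = 0
  vtx_mul_arr : ∀ ⦃a b : V⦄ (e : a ⟶ b), vtx a * arr e = arr e
  arr_mul_vtx : ∀ ⦃a b : V⦄ (e : a ⟶ b), arr e * vtx b = arr e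

namespace LiftData

variable (D : LiftData V B)

/-- The value on a path. -/
def path {a : V} : ∀ {b : V}, Quiver.Path a b → B
  | _, .nil => D.vtx a
  | _, .cons p e => path p * D.arr e

theorem vtx_mul_path {a b : V} (p : Quiver.Path a b) : D.vtx a * D.path p = D.path p := by
  induction p with
  | nil => exact D.idem a
  | cons p e ih => rw [path, ← mul_assoc, ih]

theorem path_mul_vtx {a b : V} (p : Quiver.Path a b) : D.path p * D.vtx b = D.path p := by
  cases p with
  | nil => exact D.idem a
  | cons p e => rw [path, mul_assoc, D.arr_mul_vtx]

theorem path_comp {a b c : V} (p : Quiver.Path a b) (q : Quiver.Path b c) :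
    D.path (p.comp q) = D.path p * D.path q := by
  induction q with
  | nil => rw [Quiver.Path.comp_nil, path, path_mul_vtx]
  | cons q e ih => rw [Quiver.Path.comp_cons, path, path, ih, mul_assoc]

theorem path_mul_path_of_ne {a b b' c : V} (h : b ≠ b') (p : Quiver.Path a b)
    (q : Quiver.Path b' c) : D.path p * D.path q = 0 := by
  rw [← D.path_mul_vtx p, ← D.vtx_mul_path q, mul_assoc, ← mul_assoc (D.vtx b), D.orth _ _ h,
    zero_mul, mul_zero]

/-- The algebra homomorphism from the path algebra with prescribed values on vertices and
arrows. -/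
noncomputable def lift (K : Type*) [Field K] [Algebra K B] : PathAlgebra K V →ₐ[K] B :=
  AlgHom.ofLinearMap (linearLift K fun _ _ p => D.path p)
    (by
      rw [← PathAlgebra.sum_vtx, map_sum, ← D.sum_vtx]
      exact Finset.sum_congr rfl fun a _ => linearLift_ofPath _ _)
    (by
      intro x y
      induction x using induction_on with
      | zero => simp
      | add x x' hx hx' => simp only [add_mul, map_add, hx, hx']
      | smul c x hx => simp only [smul_mul_assoc, map_smul, hx]
      | path a b p =>
      induction y using induction_on with
      | zero => simp
      | add y y' hy hy' => simp only [mul_add, map_add, hy, hy']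
      | smul c y hy => simp only [mul_smul_comm, map_smul, hy]
      | path b' c q =>
      rw [linearLift_ofPath, linearLift_ofPath]
      by_cases h : b = b'
      · subst h
        rw [ofPath_mul_ofPath, linearLift_ofPath, path_comp]
      · rw [ofPath_mul_ofPath_of_ne h, map_zero, path_mul_path_of_ne _ h])

theorem lift_vtx (a : V) : D.lift K (PathAlgebra.vtx K a) = D.vtx a :=
  linearLift_ofPath _ _

theorem lift_arr {a b : V} (e : a ⟶ b) : D.lift K (PathAlgebra.arr K e) = D.arr e := by
  refine (linearLift_ofPath _ _).trans ?_
  exact D.vtx_mul_arr e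

end LiftData

/-- Algebra homomorphisms from a path algebra are determined by their values on vertices and
arrows. -/
theorem algHom_ext {f g : PathAlgebra K V →ₐ[K] B} (hv : ∀ a, f (vtx K a) = g (vtx K a))
    (ha : ∀ (a b : V) (e : a ⟶ b), f (arr K e) = g (arr K e)) : f = g := by
  refine AlgHom.ext fun x => ?_
  induction x using induction_on with
  | zero => simp
  | add x x' hx hx' => simp only [map_add, hx, hx']
  | smul c x hx => simp only [map_smul, hx]
  | path a b p =>
    induction p with
    | nil => exact hv a
    | cons p e ih => rw [ofPath_cons, map_mul, map_mul, ih, ha]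

/-- The path algebra is generated by the vertices and arrows: a subspace of a target algebra that
contains `x` and is stable under right multiplication by the images of the vertices and arrows
contains `x * f y` for all `y`. -/
theorem mul_mem_of_generators (f : PathAlgebra K V →ₐ[K] B) (S : Submodule K B)
    (hv : ∀ x ∈ S, ∀ a, x * f (vtx K a) ∈ S)
    (ha : ∀ x ∈ S, ∀ (a b : V) (e : a ⟶ b), x * f (arr K e) ∈ S)
    {x : B} (hx : x ∈ S) (y : PathAlgebra K V) : x * f y ∈ S := by
  induction y using induction_on with
  | zero => simp
  | add y y' h h' =>
    rw [map_add, mul_add]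
    exact S.add_mem h h'
  | smul c y h =>
    rw [map_smul, mul_smul_comm]
    exact S.smul_mem c h
  | path a b p =>
    induction p with
    | nil => exact hv x hx a
    | cons p e ih =>
      rw [ofPath_cons, map_mul, ← mul_assoc]
      exact ha _ ih _ _ e

/-- Commuting with the images of the vertices and arrows suffices for commuting with all images. -/
theorem commute_of_generators (f : PathAlgebra K V →ₐ[K] B) {z : B}
    (hv : ∀ a, Commute z (f (vtx K a))) (ha : ∀ (a b : V) (e : a ⟶ b), Commute z (f (arr K e)))
    (y : PathAlgebra K V) : Commute z (f y) := by
  induction y using induction_on with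
  | zero => simp
  | add y y' h h' => simpa only [map_add] using h.add_right h'
  | smul c y h => simpa only [map_smul] using h.smul_right c
  | path a b p =>
    induction p with
    | nil => exact hv a
    | cons p e ih =>
      rw [ofPath_cons, map_mul]
      exact ih.mul_right (ha _ _ e)

end PathAlgebra

/-! ### Quotients by two-sided ideals -/

namespace TwoSidedIdeal

variable {K A B : Type*} [Field K] [Ring A] [Algebra K A] [Ring B] [Algebra K B]

/-- The quotient map, as an algebra homomorphism. -/
def mkAlg (K : Type*) {A : Type*} [Field K] [Ring A] [Algebra K A] (I : TwoSidedIdeal A) :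
    A →ₐ[K] I.ringCon.Quotient :=
  I.ringCon.mkₐ K

theorem mkAlg_surjective (I : TwoSidedIdeal A) : Function.Surjective (mkAlg K I) :=
  Quotient.mk''_surjective

theorem mkAlg_eq_zero_iff (I : TwoSidedIdeal A) (x : A) : mkAlg K I x = 0 ↔ x ∈ I := by
  have h := I.ker_ringCon_mk'
  conv_rhs => rw [← h, mem_ker]
  rfl

/-- The homomorphism on the quotient induced by a homomorphism that vanishes on the ideal. -/
def liftAlg (I : TwoSidedIdeal A) (f : A →ₐ[K] B) (h : ∀ x ∈ I, f x = 0) :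
    I.ringCon.Quotient →ₐ[K] B :=
  { I.ringCon.lift (f : A →+* B) (fun x y hxy => by
      have := h _ ((I.rel_iff x y).1 hxy)
      rwa [map_sub, sub_eq_zero] at this) with
    commutes' := fun r => f.commutes r }

theorem apply_eq_zero_of_mem_span {S : Set A} (f : A →ₐ[K] B) (h : ∀ x ∈ S, f x = 0) {x : A}
    (hx : x ∈ span S) : f x = 0 := by
  have : span S ≤ ker f := span_le.2 fun y hy => (mem_ker f).2 (h y hy)
  exact (mem_ker f).1 (this hx)

/-- A linear map that vanishes on the ideal factors through the quotient. -/
theorem exists_linearMap_factor {M : Type*} [AddCommGroup M] [Module K M] (I : TwoSidedIdeal A)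
    (φ : A →ₗ[K] M) (h : ∀ x ∈ I, φ x = 0) :
    ∃ ψ : I.ringCon.Quotient →ₗ[K] M, ∀ x, ψ (mkAlg K I x) = φ x := by
  let m := (mkAlg K I).toLinearMap
  have hle : LinearMap.ker m ≤ LinearMap.ker φ := fun x hx =>
    h x ((mkAlg_eq_zero_iff (K := K) I x).1 hx)
  refine ⟨(Submodule.liftQ _ φ hle).comp
    (m.quotKerEquivOfSurjective (mkAlg_surjective (K := K) I)).symm.toLinearMap, fun x => ?_⟩
  have : (m.quotKerEquivOfSurjective (mkAlg_surjective (K := K) I)).symm (m x)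
      = Submodule.Quotient.mk x := by
    rw [LinearEquiv.symm_apply_eq]
    rfl
  exact (congrArg (Submodule.liftQ _ φ hle) this).trans (Submodule.liftQ_apply _ _ _)

/-- A linear map vanishes on the ideal generated by `S` if it vanishes on all `u * s * v`. -/
theorem linearMap_eq_zero_of_mem_span {M : Type*} [AddCommGroup M] [Module K M] {S : Set A}
    (φ : A →ₗ[K] M) (h : ∀ s ∈ S, ∀ u v, φ (u * s * v) = 0) {x : A} (hx : x ∈ span S) :
    φ x = 0 := by
  let J : TwoSidedIdeal A := TwoSidedIdeal.mk' {x | ∀ u v, φ (u * x * v) = 0}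
    (by simp) (fun hx hy u v => by rw [mul_add, add_mul, map_add, hx, hy, add_zero])
    (fun hx u v => by rw [mul_neg, neg_mul, map_neg, hx, neg_zero])
    (fun {x y} hy u v => by simpa only [mul_assoc] using hy (u * x) v)
    (fun {x y} hx u v => by simpa only [mul_assoc] using hx u (y * v))
  have hJ : span S ≤ J := span_le.2 fun s hs => by
    rw [SetLike.mem_coe, TwoSidedIdeal.mem_mk']
    exact h s hs
  have := hJ hx
  rw [TwoSidedIdeal.mem_mk'] at this
  simpa using this 1 1

/-- Mutually inverse homomorphisms that respect the ideals induce an isomorphism of quotients. -/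
noncomputable def quotientEquiv (I : TwoSidedIdeal A) (J : TwoSidedIdeal B) (f : A →ₐ[K] B)
    (g : B →ₐ[K] A) (hf : ∀ x ∈ I, f x ∈ J) (hg : ∀ x ∈ J, g x ∈ I) (hgf : ∀ x, g (f x) = x)
    (hfg : ∀ x, f (g x) = x) : I.ringCon.Quotient ≃ₐ[K] J.ringCon.Quotient :=
  AlgEquiv.ofAlgHom
    (liftAlg I ((mkAlg K J).comp f) fun x hx => (mkAlg_eq_zero_iff (K := K) J _).2 (hf x hx))
    (liftAlg J ((mkAlg K I).comp g) fun x hx => (mkAlg_eq_zero_iff (K := K) I _).2 (hg x hx))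
    (by
      refine AlgHom.ext fun x => ?_
      obtain ⟨x, rfl⟩ := mkAlg_surjective (K := K) J x
      exact congrArg (mkAlg K J) (hfg x))
    (by
      refine AlgHom.ext fun x => ?_
      obtain ⟨x, rfl⟩ := mkAlg_surjective (K := K) I x
      exact congrArg (mkAlg K I) (hgf x))

end TwoSidedIdeal

/-! ### Walks around a vertex of a Brauer graph -/

namespace BrauerGraph

variable {Γ : BrauerGraph.{u}} {K : Type v} [Field K]

/-- The idempotent of the path algebra given by an edge. -/
noncomputable def idem (K : Type v) [Field K] (i : Γ.E) : PathAlgebra K Γ.QuiverVertex :=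
  PathAlgebra.vtx (V := Γ.QuiverVertex) K i

theorem arr_eq_elt {i j : Γ.QuiverVertex} (e : i ⟶ j) : PathAlgebra.arr K e = e.1.elt K := by
  obtain ⟨a, rfl, rfl⟩ := e
  rfl

theorem idem_mul_elt (a : Γ.Arrow) : idem K a.source * a.elt K = a.elt K :=
  PathAlgebra.vtx_mul_arr a.hom

theorem elt_mul_idem (a : Γ.Arrow) : a.elt K * idem K a.target = a.elt K :=
  PathAlgebra.arr_mul_vtx a.hom

theorem idem_mul_elt_of_ne {i : Γ.E} {a : Γ.Arrow} (h : i ≠ a.source) : idem K i * a.elt K = 0 :=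
  PathAlgebra.vtx_mul_ofPath_of_ne (V := Γ.QuiverVertex) h _

theorem elt_mul_idem_of_ne {i : Γ.E} {a : Γ.Arrow} (h : a.target ≠ i) : a.elt K * idem K i = 0 :=
  PathAlgebra.ofPath_mul_vtx_of_ne (V := Γ.QuiverVertex) h _

theorem elt_mul_elt_of_ne {a b : Γ.Arrow} (h : a.target ≠ b.source) : a.elt K * b.elt K = 0 :=
  PathAlgebra.ofPath_mul_ofPath_of_ne (V := Γ.QuiverVertex) h _ _

/-- The list of the `n` successive arrows that starts at the half-edge `h`. -/
def walkList (h : Γ.NonTrunc) (n : ℕ) : List Γ.Arrow :=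
  (List.range n).map fun r => Arrow.ofSucc (Γ.next^[r] h)

/-- The path of the `n` successive arrows around a vertex that starts at the half-edge `h`, as an
element of the path algebra. For `n = 0` it is `1`, not the trivial path at the edge of `h`. -/
noncomputable def walk (K : Type v) [Field K] (h : Γ.NonTrunc) (n : ℕ) :
    PathAlgebra K Γ.QuiverVertex :=
  ((walkList h n).map fun a => a.elt K).prod

theorem walkList_succ (h : Γ.NonTrunc) (n : ℕ) :
    walkList h (n + 1) = walkList h n ++ [Arrow.ofSucc (Γ.next^[n] h)] := by
  simp [walkList, List.range_succ]

theorem length_walkList (h : Γ.NonTrunc) (n : ℕ) : (walkList h n).length = n := by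
  simp [walkList]

theorem walkList_eq_append_cons {h : Γ.NonTrunc} {n : ℕ} {l t : List Γ.Arrow} {a : Γ.Arrow}
    (e : walkList h n = l ++ a :: t) : a = Arrow.ofSucc (Γ.next^[l.length] h) := by
  have hl : l.length < n := by
    have := congrArg List.length e
    rw [length_walkList] at this
    simp at this
    omega
  have h1 : (l ++ a :: t)[l.length]? = some a := by simp
  rw [← e] at h1
  simpa [walkList, hl, eq_comm] using h1

theorem walk_zero (h : Γ.NonTrunc) : walk K h 0 = 1 := rfl

theorem walk_succ (h : Γ.NonTrunc) (n : ℕ) :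
    walk K h (n + 1) = walk K h n * (Arrow.ofSucc (Γ.next^[n] h)).elt K := by
  simp [walk, walkList_succ]

theorem walk_one (h : Γ.NonTrunc) : walk K h 1 = (Arrow.ofSucc h).elt K := by
  rw [walk_succ, walk_zero, one_mul]
  rfl

theorem walk_add (h : Γ.NonTrunc) (m n : ℕ) :
    walk K h (m + n) = walk K h m * walk K (Γ.next^[m] h) n := by
  induction n with
  | zero => rw [walk_zero, mul_one, add_zero]
  | succ n ih =>
    rw [← add_assoc, walk_succ, ih, walk_succ, mul_assoc, add_comm m n, Function.iterate_add_apply]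

theorem walk_succ' (h : Γ.NonTrunc) (n : ℕ) :
    walk K h (n + 1) = (Arrow.ofSucc h).elt K * walk K (Γ.next h) n := by
  rw [add_comm, walk_add, walk_one]
  rfl

theorem idem_mul_walk (h : Γ.NonTrunc) {n : ℕ} (hn : n ≠ 0) :
    idem K (Γ.edge h) * walk K h n = walk K h n := by
  obtain ⟨n, rfl⟩ := Nat.exists_eq_succ_of_ne_zero hn
  rw [Nat.succ_eq_add_one, walk_succ', ← mul_assoc, show Γ.edge h = (Arrow.ofSucc h).source from rfl,
    idem_mul_elt]

theorem idem_mul_walk_of_ne {i : Γ.E} {h : Γ.NonTrunc} (hi : i ≠ Γ.edge h) {n : ℕ} (hn : n ≠ 0) :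
    idem K i * walk K h n = 0 := by
  obtain ⟨n, rfl⟩ := Nat.exists_eq_succ_of_ne_zero hn
  rw [Nat.succ_eq_add_one, walk_succ', ← mul_assoc, idem_mul_elt_of_ne hi, zero_mul]

theorem coe_next_iterate (h : Γ.NonTrunc) (n : ℕ) :
    ((Γ.next^[n] h : Γ.NonTrunc) : Γ.H) = Γ.succ^[n] h := by
  induction n with
  | zero => rfl
  | succ n ih =>
    rw [Function.iterate_succ_apply', Function.iterate_succ_apply', ← ih]
    rfl

theorem walk_mul_idem (h : Γ.NonTrunc) {n : ℕ} (hn : n ≠ 0) :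
    walk K h n * idem K (Γ.edge (Γ.next^[n] h : Γ.NonTrunc)) = walk K h n := by
  obtain ⟨n, rfl⟩ := Nat.exists_eq_succ_of_ne_zero hn
  rw [Nat.succ_eq_add_one, walk_succ, mul_assoc, Function.iterate_succ_apply']
  exact congrArg (_ * ·) (elt_mul_idem (K := K) (Arrow.ofSucc (Γ.next^[n] h)))

theorem walk_mul_idem_of_ne {i : Γ.E} (h : Γ.NonTrunc) {n : ℕ} (hn : n ≠ 0)
    (hi : Γ.edge (Γ.next^[n] h : Γ.NonTrunc) ≠ i) : walk K h n * idem K i = 0 := by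
  obtain ⟨n, rfl⟩ := Nat.exists_eq_succ_of_ne_zero hn
  rw [Nat.succ_eq_add_one, Function.iterate_succ_apply'] at hi
  rw [Nat.succ_eq_add_one, walk_succ, mul_assoc]
  exact (congrArg (_ * ·) (elt_mul_idem_of_ne (K := K) (a := .ofSucc (Γ.next^[n] h)) hi)).trans
    (mul_zero _)

theorem vert_next_iterate (h : Γ.NonTrunc) (n : ℕ) :
    Γ.vert (Γ.next^[n] h : Γ.NonTrunc) = Γ.vert h := by
  induction n with
  | zero => rfl
  | succ n ih => rw [Function.iterate_succ_apply', ← ih]; exact Γ.vert_succ _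

theorem next_injective : Function.Injective Γ.next := fun _ _ e =>
  Subtype.ext (Γ.succ.injective (congrArg Subtype.val e))

theorem mem_periodicPts_succ (h : Γ.H) : h ∈ Function.periodicPts Γ.succ :=
  ⟨orderOf Γ.succ, orderOf_pos _, by
    rw [Function.IsPeriodicPt, Function.IsFixedPt, ← Equiv.Perm.coe_pow, pow_orderOf_eq_one]; rfl⟩

/-- The valency of a vertex is the length of the cycle of the successor permutation. -/
theorem val_vert (h : Γ.H) : Γ.val (Γ.vert h) = Function.minimalPeriod Γ.succ h := by
  have hp := Function.minimalPeriod_pos_of_mem_periodicPts (mem_periodicPts_succ h)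
  have hv : ∀ n : ℕ, Γ.vert (Γ.succ^[n] h) = Γ.vert h := fun n => by
    refine ((Γ.vert_eq_iff _ _).2 ⟨n, ?_⟩).symm
    rw [zpow_natCast, Equiv.Perm.coe_pow]
  have hbij : Function.Bijective fun n : Fin (Function.minimalPeriod Γ.succ h) =>
      (⟨Γ.succ^[n] h, hv n⟩ : {k // Γ.vert k = Γ.vert h}) := by
    constructor
    · intro a b hab
      exact Fin.ext (Function.iterate_injOn_Iio_minimalPeriod a.2 b.2 (congrArg Subtype.val hab))
    · rintro ⟨k, hk⟩
      obtain ⟨n, hn⟩ := ((Γ.vert_eq_iff _ _).1 hk.symm).exists_nat_pow_eq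
      refine ⟨⟨n % Function.minimalPeriod Γ.succ h, Nat.mod_lt _ hp⟩, Subtype.ext ?_⟩
      change Γ.succ^[n % Function.minimalPeriod Γ.succ h] h = k
      rw [Function.iterate_mod_minimalPeriod_eq, ← Equiv.Perm.coe_pow, hn]
  rw [val, ← Nat.card_eq_of_bijective _ hbij, Nat.card_eq_fintype_card, Fintype.card_fin]

theorem succ_iterate_eq_self_iff (h : Γ.H) (n : ℕ) :
    Γ.succ^[n] h = h ↔ Γ.val (Γ.vert h) ∣ n := by
  rw [val_vert]
  exact Function.isPeriodicPt_iff_minimalPeriod_dvd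

theorem val_pos (h : Γ.H) : 0 < Γ.val (Γ.vert h) := by
  rw [val_vert]
  exact Function.minimalPeriod_pos_of_mem_periodicPts (mem_periodicPts_succ h)

/-- The length of the path `C_{i, μ} ^ m(μ)`, the pair `(i, μ)` being given by the half-edge `h`. -/
noncomputable def len (h : Γ.H) : ℕ := Γ.val (Γ.vert h) * Γ.mult (Γ.vert h)

theorem len_pos (h : Γ.H) : 0 < len h := Nat.mul_pos (val_pos h) (Γ.mult_pos _)

theorem isTruncated_iff_len (h : Γ.H) : Γ.IsTruncated h ↔ len h = 1 :=
  mul_eq_one.symm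

theorem len_congr {h k : Γ.H} (e : Γ.vert h = Γ.vert k) : len h = len k := by
  rw [len, len, e]

theorem len_next_iterate (h : Γ.NonTrunc) (n : ℕ) :
    len (Γ.next^[n] h : Γ.NonTrunc).1 = len h.1 :=
  len_congr (vert_next_iterate h n)

theorem next_iterate_val_mul (h : Γ.NonTrunc) (n : ℕ) :
    Γ.next^[Γ.val (Γ.vert h) * n] h = h :=
  Subtype.ext ((coe_next_iterate h _).trans ((succ_iterate_eq_self_iff _ _).2 (dvd_mul_right _ _)))

theorem next_iterate_len (h : Γ.NonTrunc) : Γ.next^[len h.1] h = h := next_iterate_val_mul h _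

theorem cycle_eq_walk (h : Γ.NonTrunc) : Γ.cycle K h = walk K h (Γ.val (Γ.vert h)) := rfl

theorem cycle_pow (h : Γ.NonTrunc) (n : ℕ) :
    Γ.cycle K h ^ n = walk K h (Γ.val (Γ.vert h) * n) := by
  induction n with
  | zero => rfl
  | succ n ih => rw [pow_succ, ih, mul_add, mul_one, walk_add, next_iterate_val_mul, cycle_eq_walk]

theorem cycle_pow_mult (h : Γ.NonTrunc) : Γ.cycle K h ^ Γ.mult (Γ.vert h) = walk K h (len h.1) :=
  cycle_pow h _

theorem edge_opp (h : Γ.H) : Γ.edge (Γ.opp h) = Γ.edge h :=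
  ((Γ.edge_eq_iff h (Γ.opp h)).2 (Or.inr rfl)).symm

end BrauerGraph

namespace QuantizedBrauerGraph

open BrauerGraph

variable {K : Type v} [Field K] (Γ : QuantizedBrauerGraph.{u, v} K)

/-! ### Multiplication in a Brauer graph algebra -/

/-- The quotient map from the path algebra onto the Brauer graph algebra. -/
noncomputable def toAlg : PathAlgebra K Γ.QuiverVertex →ₐ[K] Γ.Alg :=
  TwoSidedIdeal.mkAlg K Γ.ideal

theorem toAlg_eq_zero_iff (x : PathAlgebra K Γ.QuiverVertex) : Γ.toAlg x = 0 ↔ x ∈ Γ.ideal :=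
  TwoSidedIdeal.mkAlg_eq_zero_iff _ _

variable {Γ}

theorem toAlg_relation {x : PathAlgebra K Γ.QuiverVertex} (h : Γ.Relation x) : Γ.toAlg x = 0 :=
  (Γ.toAlg_eq_zero_iff x).2 (TwoSidedIdeal.subset_span h)

theorem toAlg_elt_mul_elt {h k : Γ.NonTrunc} (hk : k ≠ Γ.next h) :
    Γ.toAlg ((Arrow.ofSucc h).elt K * (Arrow.ofSucc k).elt K) = 0 := by
  by_cases e : Γ.edge (Γ.succ h) = Γ.edge k
  · exact toAlg_relation (.three h k e hk)
  · rw [elt_mul_elt_of_ne (a := .ofSucc h) (b := .ofSucc k) e, map_zero]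

theorem toAlg_walk_mul_elt {h k : Γ.NonTrunc} {n : ℕ} (hn : n ≠ 0) (hk : k ≠ Γ.next^[n] h) :
    Γ.toAlg (walk K h n * (Arrow.ofSucc k).elt K) = 0 := by
  obtain ⟨n, rfl⟩ := Nat.exists_eq_succ_of_ne_zero hn
  rw [Nat.succ_eq_add_one, Function.iterate_succ_apply'] at hk
  rw [Nat.succ_eq_add_one, walk_succ, mul_assoc, map_mul, toAlg_elt_mul_elt hk, mul_zero]

theorem toAlg_walk_mul_walk {h k : Γ.NonTrunc} {m n : ℕ} (hm : m ≠ 0) (hn : n ≠ 0)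
    (hk : k ≠ Γ.next^[m] h) : Γ.toAlg (walk K h m * walk K k n) = 0 := by
  obtain ⟨n, rfl⟩ := Nat.exists_eq_succ_of_ne_zero hn
  rw [Nat.succ_eq_add_one, walk_succ', ← mul_assoc, map_mul, toAlg_walk_mul_elt hm hk, zero_mul]

theorem toAlg_walk_len_succ (h : Γ.NonTrunc) : Γ.toAlg (walk K h (len h.1 + 1)) = 0 := by
  rw [walk_succ, next_iterate_len]
  by_cases hν : Γ.IsTruncated (Γ.opp h)
  · have := toAlg_relation (.two h hν)
    rwa [cycle_pow_mult] at this
  · have h1 := toAlg_relation (.one (Γ := Γ) h.1 h.2 hν)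
    rw [cycle_pow_mult, cycle_pow_mult, map_sub, map_smul, map_smul, sub_eq_zero] at h1
    have h2 : Γ.toAlg (walk K (⟨Γ.opp h, hν⟩ : Γ.NonTrunc) (len (Γ.opp h.1)) *
        (Arrow.ofSucc h).elt K) = 0 := by
      refine toAlg_walk_mul_elt (len_pos _).ne' ?_
      rw [next_iterate_len (⟨Γ.opp h, hν⟩ : Γ.NonTrunc)]
      exact fun e => Γ.opp_ne h.1 (congrArg Subtype.val e).symm
    have h3 := congrArg (· * Γ.toAlg ((Arrow.ofSucc h).elt K)) h1
    simp only [smul_mul_assoc, ← map_mul] at h3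
    rw [h2, smul_zero] at h3
    exact (smul_eq_zero.1 h3).resolve_left (Units.ne_zero _)

theorem toAlg_walk_of_len_lt (h : Γ.NonTrunc) {n : ℕ} (hn : len h.1 < n) :
    Γ.toAlg (walk K h n) = 0 := by
  obtain ⟨k, rfl⟩ := Nat.exists_eq_add_of_le (Nat.succ_le_of_lt hn)
  rw [Nat.succ_eq_add_one, walk_add, map_mul, toAlg_walk_len_succ, zero_mul]

theorem not_isTruncated_of_edge {i : Γ.E} (hi : ∀ h, Γ.edge h = i → Γ.IsTruncated h)
    (h : Γ.NonTrunc) : Γ.edge h ≠ i := fun e => h.2 (hi _ e)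

theorem elt_loop_mul_ofSucc {i : Γ.E} (hi : ∀ h, Γ.edge h = i → Γ.IsTruncated h) (h : Γ.NonTrunc) :
    (Arrow.loop i hi).elt K * (Arrow.ofSucc h).elt K = 0 :=
  elt_mul_elt_of_ne (not_isTruncated_of_edge hi h).symm

theorem elt_ofSucc_mul_loop {i : Γ.E} (hi : ∀ h, Γ.edge h = i → Γ.IsTruncated h) (h : Γ.NonTrunc) :
    (Arrow.ofSucc h).elt K * (Arrow.loop i hi).elt K = 0 :=
  elt_mul_elt_of_ne (not_isTruncated_of_edge hi (Γ.next h))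

theorem toAlg_loop_mul_loop {i j : Γ.E} (hi : ∀ h, Γ.edge h = i → Γ.IsTruncated h)
    (hj : ∀ h, Γ.edge h = j → Γ.IsTruncated h) :
    Γ.toAlg ((Arrow.loop i hi).elt K * (Arrow.loop j hj).elt K) = 0 := by
  by_cases e : i = j
  · subst e
    rw [← pow_two]
    exact toAlg_relation (.square i hi)
  · rw [elt_mul_elt_of_ne (a := .loop i hi) (b := .loop j hj) e, map_zero]

theorem toAlg_elt_pow_eq_zero (a : Γ.Arrow) : ∃ n, Γ.toAlg (a.elt K) ^ n = 0 := by
  cases a with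
  | loop i hi => exact ⟨2, by rw [pow_two, ← map_mul, toAlg_loop_mul_loop]⟩
  | ofSucc h =>
    by_cases e : Γ.next h = h
    · refine ⟨len h.1 + 1, ?_⟩
      rw [← toAlg_walk_len_succ h, ← map_pow]
      congr 1
      generalize len h.1 + 1 = n
      induction n with
      | zero => rfl
      | succ n ih => rw [pow_succ, ih, walk_succ, Function.iterate_fixed e]
    · exact ⟨2, by rw [pow_two, ← map_mul, toAlg_elt_mul_elt (Ne.symm e)]⟩

end QuantizedBrauerGraph

/-! ### A linear form on a Brauer graph algebra that detects the socle -/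

namespace BrauerGraph

variable {Γ : BrauerGraph.{u}} {K : Type v} [Field K]

/-- The arrows of a path. -/
def pathList {i : Γ.QuiverVertex} : ∀ {j : Γ.QuiverVertex}, Quiver.Path i j → List Γ.Arrow
  | _, .nil => []
  | _, .cons p e => pathList p ++ [e.1]

theorem pathList_comp {i j k : Γ.QuiverVertex} (p : Quiver.Path i j) (q : Quiver.Path j k) :
    pathList (p.comp q) = pathList p ++ pathList q := by
  induction q with
  | nil => simp [pathList]
  | cons q e ih => simp [pathList, ih]

/-- The element `x` of the path algebra is zero or the path with the list of arrows `l`. -/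
def IsMonomial (x : PathAlgebra K Γ.QuiverVertex) (l : List Γ.Arrow) : Prop :=
  x = 0 ∨ ∃ (i j : Γ.QuiverVertex) (p : Quiver.Path i j), x = PathAlgebra.ofPath K p ∧ pathList p = l

theorem isMonomial_ofPath {i j : Γ.QuiverVertex} (p : Quiver.Path i j) :
    IsMonomial (PathAlgebra.ofPath K p) (pathList p) :=
  .inr ⟨i, j, p, rfl, rfl⟩

theorem IsMonomial.mul {x y : PathAlgebra K Γ.QuiverVertex} {l t : List Γ.Arrow}
    (hx : IsMonomial x l) (hy : IsMonomial y t) : IsMonomial (x * y) (l ++ t) := by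
  obtain rfl | ⟨i, j, p, rfl, rfl⟩ := hx
  · exact .inl (zero_mul _)
  obtain rfl | ⟨j', k, q, rfl, rfl⟩ := hy
  · exact .inl (mul_zero _)
  by_cases h : j = j'
  · subst h
    rw [PathAlgebra.ofPath_mul_ofPath, ← pathList_comp]
    exact isMonomial_ofPath _
  · exact .inl (PathAlgebra.ofPath_mul_ofPath_of_ne h _ _)

theorem isMonomial_elt (a : Γ.Arrow) : IsMonomial (a.elt K) [a] :=
  .inr ⟨_, _, a.hom.toPath, rfl, rfl⟩

theorem IsMonomial.mul_prod {x : PathAlgebra K Γ.QuiverVertex} {l : List Γ.Arrow}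
    (hx : IsMonomial x l) (t : List Γ.Arrow) :
    IsMonomial (x * (t.map fun a => a.elt K).prod) (l ++ t) := by
  induction t generalizing x l with
  | nil => simpa using hx
  | cons a t ih =>
    have := ih (hx.mul (isMonomial_elt a))
    simpa [mul_assoc] using this

open Classical in
theorem idem_mul_walk_len_mul_idem (h : Γ.NonTrunc) {e : Γ.E} (he : Γ.edge h = e) (i i' : Γ.E) :
    idem K i * walk K h (len h.1) * idem K i'
      = if i = e ∧ i' = e then walk K h (len h.1) else 0 := by
  subst he
  have hl := (len_pos h.1).ne'
  split_ifs with hi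
  · obtain ⟨rfl, rfl⟩ := hi
    rw [idem_mul_walk h hl]
    have := walk_mul_idem (K := K) h hl
    rwa [next_iterate_len] at this
  · by_cases h1 : i = Γ.edge h
    · rw [mul_assoc, walk_mul_idem_of_ne h hl (by rw [next_iterate_len]; tauto), mul_zero]
    · rw [idem_mul_walk_of_ne h1 hl, zero_mul]

theorem exists_path_walkList (h : Γ.NonTrunc) (n : ℕ) :
    ∃ (j : Γ.QuiverVertex) (p : Quiver.Path (V := Γ.QuiverVertex) (Γ.edge h) j),
      j = Γ.edge (Γ.next^[n] h : Γ.NonTrunc) ∧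
      PathAlgebra.ofPath K p = idem K (Γ.edge h) * walk K h n ∧ pathList p = walkList h n := by
  induction n with
  | zero => exact ⟨_, .nil, rfl, (mul_one _).symm, rfl⟩
  | succ n ih =>
    obtain ⟨j, p, rfl, hp, hl⟩ := ih
    refine ⟨_, p.cons (Arrow.ofSucc (Γ.next^[n] h)).hom, ?_, ?_, ?_⟩
    · rw [Function.iterate_succ_apply']
      rfl
    · rw [walk_succ, ← mul_assoc, ← hp]
      exact PathAlgebra.ofPath_cons _ _
    · rw [walkList_succ, ← hl]
      rfl

theorem exists_path_walk (h : Γ.NonTrunc) {n : ℕ} (hn : n ≠ 0) :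
    ∃ (i j : Γ.QuiverVertex) (p : Quiver.Path i j),
      PathAlgebra.ofPath K p = walk K h n ∧ pathList p = walkList h n := by
  obtain ⟨j, p, -, hp, hl⟩ := exists_path_walkList (K := K) h n
  exact ⟨_, j, p, hp.trans (idem_mul_walk h hn), hl⟩

theorem isMonomial_walk (h : Γ.NonTrunc) {n : ℕ} (hn : n ≠ 0) :
    IsMonomial (walk K h n) (walkList h n) := by
  obtain ⟨i, j, p, hp, hl⟩ := exists_path_walk (K := K) h hn
  rw [← hp, ← hl]
  exact isMonomial_ofPath p

end BrauerGraph

namespace QuantizedBrauerGraph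

open BrauerGraph

variable {K : Type v} [Field K] (Γ : QuantizedBrauerGraph.{u, v} K)

open Classical in
/-- The value of the socle form on the path `C_{i, μ} ^ m(μ)`: the inverse of `q_{i, μ}` if `i` is
not truncated at its other endpoint, and `1` otherwise. -/
noncomputable def socleCoeff (h : Γ.NonTrunc) : K :=
  if hν : Γ.IsTruncated (Γ.opp h) then 1 else ((Γ.q ⟨h.1, h.2, hν⟩)⁻¹ : Kˣ)

theorem socleCoeff_ne_zero (h : Γ.NonTrunc) : Γ.socleCoeff h ≠ 0 := by
  unfold socleCoeff
  split
  · exact one_ne_zero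
  · exact Units.ne_zero _

open Classical in
/-- The socle form on paths, as a function of the list of arrows. It vanishes except on the paths
`C_{i, μ} ^ m(μ)` and on the loops of the edges that are truncated at both endpoints. -/
noncomputable def socleValue : List Γ.Arrow → K
  | [] => 0
  | .ofSucc h :: t => if Arrow.ofSucc h :: t = walkList h (len h.1) then Γ.socleCoeff h else 0
  | .loop _ _ :: t => if t = [] then 1 else 0

theorem socleValue_walkList (h : Γ.NonTrunc) {n : ℕ} (hn : n ≠ 0) :
    Γ.socleValue (walkList h n) = if n = len h.1 then Γ.socleCoeff h else 0 := by
  have e : walkList h n = Arrow.ofSucc h :: (walkList h n).tail := by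
    obtain ⟨n, rfl⟩ := Nat.exists_eq_succ_of_ne_zero hn
    simp [walkList, List.range_succ_eq_map]
  have hiff : walkList h n = walkList h (len h.1) ↔ n = len h.1 :=
    ⟨fun h' => by simpa only [length_walkList] using congrArg List.length h', fun h' => by rw [← h']⟩
  rw [e, socleValue, ← e]
  simp only [hiff]

theorem socleValue_ne_zero {l : List Γ.Arrow} (hl : Γ.socleValue l ≠ 0) :
    (∃ h : Γ.NonTrunc, l = walkList h (len h.1)) ∨ ∃ i hi, l = [Arrow.loop i hi] := by
  cases l with
  | nil => exact absurd rfl hl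
  | cons a t =>
    cases a with
    | ofSucc h =>
      refine .inl ⟨h, ?_⟩
      by_contra hne
      exact hl (by rw [socleValue, if_neg hne])
    | loop i hi =>
      refine .inr ⟨i, hi, ?_⟩
      by_contra hne
      exact hl (by rw [socleValue, if_neg (by simpa using hne)])

theorem socleValue_append_walkList {l t : List Γ.Arrow} {h : Γ.NonTrunc} {n : ℕ} (hn : n ≠ 0)
    (hlen : len h.1 < l.length + n + t.length) : Γ.socleValue (l ++ walkList h n ++ t) = 0 := by
  by_contra hne
  obtain ⟨n, rfl⟩ := Nat.exists_eq_succ_of_ne_zero hn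
  have e : walkList h (n + 1) = Arrow.ofSucc h :: (walkList h (n + 1)).tail := by
    simp [walkList, List.range_succ_eq_map]
  obtain ⟨k, hk⟩ | ⟨i, hi, hk⟩ := Γ.socleValue_ne_zero hne
  · have h1 : walkList k (len k.1) = l ++ Arrow.ofSucc h :: ((walkList h (n + 1)).tail ++ t) := by
      rw [← hk, Nat.succ_eq_add_one, e]
      simp
    have h2 := Arrow.ofSucc.inj (walkList_eq_append_cons h1)
    have h3 := congrArg List.length hk
    simp only [List.length_append, length_walkList] at h3
    rw [h2, len_next_iterate] at hlen
    omega
  · rw [Nat.succ_eq_add_one, e] at hk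
    cases l with
    | nil => simp at hk
    | cons b l => simp at hk

theorem socleValue_append_pair {l t : List Γ.Arrow} {h k : Γ.NonTrunc} (hk : k ≠ Γ.next h) :
    Γ.socleValue (l ++ [.ofSucc h, .ofSucc k] ++ t) = 0 := by
  by_contra hne
  obtain ⟨f, hf⟩ | ⟨i, hi, hf⟩ := Γ.socleValue_ne_zero hne
  · have h1 := Arrow.ofSucc.inj (walkList_eq_append_cons (l := l)
      (show walkList f (len f.1) = l ++ .ofSucc h :: (.ofSucc k :: t) by rw [← hf]; simp))
    have h2 := Arrow.ofSucc.inj (walkList_eq_append_cons (l := l ++ [.ofSucc h])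
      (show walkList f (len f.1) = (l ++ [.ofSucc h]) ++ .ofSucc k :: t by rw [← hf]; simp))
    rw [List.length_append, List.length_singleton, Function.iterate_succ_apply', ← h1] at h2
    exact hk h2
  · have := congrArg List.length hf
    simp at this
    omega

theorem socleValue_append_loop_loop {l t : List Γ.Arrow} {i : Γ.E}
    (hi : ∀ h, Γ.edge h = i → Γ.IsTruncated h) :
    Γ.socleValue (l ++ [.loop i hi, .loop i hi] ++ t) = 0 := by
  by_contra hne
  obtain ⟨f, hf⟩ | ⟨i, hi, hf⟩ := Γ.socleValue_ne_zero hne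
  · have h1 := walkList_eq_append_cons (l := l)
      (show walkList f (len f.1) = l ++ .loop i hi :: (.loop i hi :: t) by rw [← hf]; simp)
    cases h1
  · have := congrArg List.length hf
    simp at this
    omega

/-- The linear form on the path algebra that is given by `socleValue` on paths. -/
noncomputable def pathForm : PathAlgebra K Γ.QuiverVertex →ₗ[K] K :=
  PathAlgebra.linearLift K fun _ _ p => Γ.socleValue (pathList p)

theorem pathForm_ofPath {i j : Γ.QuiverVertex} (p : Quiver.Path i j) :
    Γ.pathForm (PathAlgebra.ofPath K p) = Γ.socleValue (pathList p) :=
  PathAlgebra.linearLift_ofPath _ p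

theorem pathForm_eq_zero {x : PathAlgebra K Γ.QuiverVertex} {l : List Γ.Arrow}
    (hx : IsMonomial x l) (hl : Γ.socleValue l = 0) : Γ.pathForm x = 0 := by
  obtain rfl | ⟨i, j, p, rfl, rfl⟩ := hx
  · exact map_zero _
  · rw [pathForm_ofPath, hl]

theorem pathForm_walk (h : Γ.NonTrunc) {n : ℕ} (hn : n ≠ 0) :
    Γ.pathForm (walk K h n) = if n = len h.1 then Γ.socleCoeff h else 0 := by
  obtain ⟨i, j, p, hp, hl⟩ := exists_path_walk (K := K) h hn
  rw [← hp, pathForm_ofPath, hl, socleValue_walkList _ _ hn]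

theorem pathForm_loop {i : Γ.E} (hi : ∀ h, Γ.edge h = i → Γ.IsTruncated h) :
    Γ.pathForm ((Arrow.loop i hi).elt K) = 1 := by
  refine (Γ.pathForm_ofPath _).trans ?_
  change Γ.socleValue [Arrow.loop i hi] = 1
  rw [socleValue, if_pos rfl]

theorem pathForm_relation_one (h : Γ.H) (hμ : ¬ Γ.IsTruncated h) (hν : ¬ Γ.IsTruncated (Γ.opp h)) :
    Γ.pathForm ((Γ.q ⟨h, hμ, hν⟩ : K) • Γ.cycle K ⟨h, hμ⟩ ^ Γ.mult (Γ.vert h) -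
      (Γ.q ⟨Γ.opp h, hν, by rwa [Γ.opp_opp]⟩ : K) •
        Γ.cycle K ⟨Γ.opp h, hν⟩ ^ Γ.mult (Γ.vert (Γ.opp h))) = 0 := by
  rw [cycle_pow_mult (⟨h, hμ⟩ : Γ.NonTrunc), cycle_pow_mult (⟨Γ.opp h, hν⟩ : Γ.NonTrunc), map_sub,
    map_smul, map_smul, pathForm_walk _ _ (len_pos _).ne', pathForm_walk _ _ (len_pos _).ne',
    if_pos rfl, if_pos rfl, socleCoeff, socleCoeff, dif_neg hν,
    dif_neg (show ¬ Γ.IsTruncated (Γ.opp (Γ.opp h)) by rwa [Γ.opp_opp])]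
  simp

theorem pathForm_idem_mul_relation_one_mul_idem (h : Γ.H) (hμ : ¬ Γ.IsTruncated h)
    (hν : ¬ Γ.IsTruncated (Γ.opp h)) (i i' : Γ.E) :
    Γ.pathForm (idem K i * ((Γ.q ⟨h, hμ, hν⟩ : K) • Γ.cycle K ⟨h, hμ⟩ ^ Γ.mult (Γ.vert h) -
      (Γ.q ⟨Γ.opp h, hν, by rwa [Γ.opp_opp]⟩ : K) •
        Γ.cycle K ⟨Γ.opp h, hν⟩ ^ Γ.mult (Γ.vert (Γ.opp h))) * idem K i') = 0 := by
  have h0 := Γ.pathForm_relation_one h hμ hν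
  rw [cycle_pow_mult (⟨h, hμ⟩ : Γ.NonTrunc), cycle_pow_mult (⟨Γ.opp h, hν⟩ : Γ.NonTrunc)] at h0 ⊢
  rw [mul_sub, sub_mul, mul_smul_comm, mul_smul_comm, smul_mul_assoc, smul_mul_assoc,
    idem_mul_walk_len_mul_idem (⟨h, hμ⟩ : Γ.NonTrunc) rfl,
    idem_mul_walk_len_mul_idem (⟨Γ.opp h, hν⟩ : Γ.NonTrunc) (edge_opp h)]
  split_ifs
  · exact h0
  · simp

/-- The socle form vanishes on the multiples of the relations by paths. -/
theorem pathForm_mul_relation_mul {x : PathAlgebra K Γ.QuiverVertex} (hx : Γ.Relation x)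
    {i j i' j' : Γ.QuiverVertex} (p : Quiver.Path i j) (q : Quiver.Path i' j') :
    Γ.pathForm (PathAlgebra.ofPath K p * x * PathAlgebra.ofPath K q) = 0 := by
  have hp := isMonomial_ofPath (K := K) p
  have hq := isMonomial_ofPath (K := K) q
  have hw : ∀ (h : Γ.NonTrunc) (n : ℕ), IsMonomial
      (PathAlgebra.ofPath K p * walk K h n * PathAlgebra.ofPath K q)
      (pathList p ++ walkList h n ++ pathList q) := fun h n => (hp.mul_prod _).mul hq
  cases hx with
  | one h hμ hν =>
    by_cases hpq : 0 < (pathList p).length + (pathList q).length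
    · have hz : ∀ k : Γ.NonTrunc,
          Γ.pathForm (PathAlgebra.ofPath K p * walk K k (len k.1) * PathAlgebra.ofPath K q) = 0 :=
        fun k => Γ.pathForm_eq_zero (hw k _)
          (Γ.socleValue_append_walkList (len_pos _).ne' (by omega))
      have h1 := hz ⟨h, hμ⟩
      have h2 := hz ⟨Γ.opp h, hν⟩
      rw [cycle_pow_mult (⟨h, hμ⟩ : Γ.NonTrunc), cycle_pow_mult (⟨Γ.opp h, hν⟩ : Γ.NonTrunc), mul_sub,
        sub_mul, map_sub, mul_smul_comm, mul_smul_comm, smul_mul_assoc, smul_mul_assoc, map_smul,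
        map_smul, h1, h2, smul_zero, smul_zero, sub_zero]
    · cases p with
      | cons p e => simp [pathList] at hpq
      | nil =>
        cases q with
        | cons q e => simp [pathList] at hpq
        | nil =>
          exact Γ.pathForm_idem_mul_relation_one_mul_idem h hμ hν i i'
  | two h hμ =>
    have := hw h (len h.1 + 1)
    rw [walk_succ, next_iterate_len] at this
    rw [cycle_pow_mult]
    exact Γ.pathForm_eq_zero this (Γ.socleValue_append_walkList (by omega) (by omega))
  | three h k hk hne =>
    have := (hp.mul ((isMonomial_elt (.ofSucc h)).mul (isMonomial_elt (.ofSucc k)))).mul hq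
    exact Γ.pathForm_eq_zero this (Γ.socleValue_append_pair hne)
  | square i hi =>
    have := (hp.mul ((isMonomial_elt (.loop i hi)).mul (isMonomial_elt (.loop i hi)))).mul hq
    rw [pow_two]
    exact Γ.pathForm_eq_zero this (Γ.socleValue_append_loop_loop hi)

theorem pathForm_eq_zero_of_mem {x : PathAlgebra K Γ.QuiverVertex} (hx : x ∈ Γ.ideal) :
    Γ.pathForm x = 0 := by
  refine TwoSidedIdeal.linearMap_eq_zero_of_mem_span _ (fun s hs u v => ?_) hx
  induction u using PathAlgebra.induction_on with
  | zero => simp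
  | add u u' h h' => rw [add_mul, add_mul, map_add, h, h', add_zero]
  | smul c u h => rw [smul_mul_assoc, smul_mul_assoc, map_smul, h, smul_zero]
  | path i j p =>
    induction v using PathAlgebra.induction_on with
    | zero => simp
    | add v v' h h' => rw [mul_add, map_add, h, h', add_zero]
    | smul c v h => rw [mul_smul_comm, map_smul, h, smul_zero]
    | path i' j' q => exact Γ.pathForm_mul_relation_mul hs p q

theorem exists_socleForm :
    ∃ ψ : Γ.Alg →ₗ[K] K, ∀ x, ψ (Γ.toAlg x) = Γ.pathForm x :=
  TwoSidedIdeal.exists_linearMap_factor _ _ fun _ hx => Γ.pathForm_eq_zero_of_mem hx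

/-- The path `C_{i, μ} ^ m(μ)` is nonzero in the Brauer graph algebra. -/
theorem toAlg_walk_len_ne_zero (h : Γ.NonTrunc) : Γ.toAlg (walk K h (len h.1)) ≠ 0 := fun h0 => by
  have := Γ.pathForm_eq_zero_of_mem ((Γ.toAlg_eq_zero_iff _).1 h0)
  rw [pathForm_walk _ _ (len_pos _).ne', if_pos rfl] at this
  exact Γ.socleCoeff_ne_zero h this

end QuantizedBrauerGraph

/-! ### The right socle of a Brauer graph algebra is central -/

namespace QuantizedBrauerGraph

open BrauerGraph

variable {K : Type v} [Field K] (Γ : QuantizedBrauerGraph.{u, v} K)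

/-- Indices of the standard basis of a Brauer graph algebra: the edges; the pairs `⟨h, n⟩`, which
stand for the path of length `n + 1` that starts at `h`; and the edges truncated at both endpoints,
which stand for their loops. The paths `C_{i, μ} ^ m(μ)` and `C_{i, ν} ^ m(ν)` have different
indices, although they are proportional in the algebra. -/
abbrev BasisIndex : Type u :=
  Γ.E ⊕ (Σ h : Γ.NonTrunc, Fin (len h.1)) ⊕ {i : Γ.E // ∀ h, Γ.edge h = i → Γ.IsTruncated h}

/-- The element of the Brauer graph algebra with the given index. -/
noncomputable def basisElt : Γ.BasisIndex → Γ.Alg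
  | .inl i => Γ.toAlg (idem K i)
  | .inr (.inl x) => Γ.toAlg (walk K x.1 (x.2 + 1))
  | .inr (.inr i) => Γ.toAlg ((Arrow.loop i.1 i.2).elt K)

theorem span_basisElt : Submodule.span K (Set.range Γ.basisElt) = ⊤ := by
  classical
  have mem : ∀ j, Γ.basisElt j ∈ Submodule.span K (Set.range Γ.basisElt) :=
    fun j => Submodule.subset_span ⟨j, rfl⟩
  have walk_mem : ∀ (h : Γ.NonTrunc) (n : ℕ), n ≠ 0 →
      Γ.toAlg (walk K h n) ∈ Submodule.span K (Set.range Γ.basisElt) := fun h n hn => by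
    by_cases hl : len h.1 < n
    · rw [toAlg_walk_of_len_lt h hl]
      exact Submodule.zero_mem _
    · obtain ⟨n, rfl⟩ := Nat.exists_eq_succ_of_ne_zero hn
      exact mem (.inr (.inl ⟨h, ⟨n, by omega⟩⟩))
  have elt_mem : ∀ a : Γ.Arrow, Γ.toAlg (a.elt K) ∈ Submodule.span K (Set.range Γ.basisElt) := by
    rintro (h | ⟨i, hi⟩)
    · rw [← walk_one]
      exact walk_mem h 1 one_ne_zero
    · exact mem (.inr (.inr ⟨i, hi⟩))
  have key : ∀ g : Γ.Alg, (∀ j, Γ.basisElt j * g ∈ Submodule.span K (Set.range Γ.basisElt)) →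
      ∀ x ∈ Submodule.span K (Set.range Γ.basisElt),
        x * g ∈ Submodule.span K (Set.range Γ.basisElt) := fun g hg x hx => by
    induction hx using Submodule.span_induction with
    | mem x hx =>
      obtain ⟨j, rfl⟩ := hx
      exact hg j
    | zero => rw [zero_mul]; exact Submodule.zero_mem _
    | add x y _ _ hx hy => rw [add_mul]; exact Submodule.add_mem _ hx hy
    | smul c x _ hx => rw [smul_mul_assoc]; exact Submodule.smul_mem _ _ hx
  have hone : (1 : Γ.Alg) ∈ Submodule.span K (Set.range Γ.basisElt) := by
    rw [← map_one Γ.toAlg, ← PathAlgebra.sum_vtx, map_sum]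
    exact Submodule.sum_mem _ fun i _ => mem (.inl i)
  refine eq_top_iff.2 fun y _ => ?_
  obtain ⟨y, rfl⟩ := TwoSidedIdeal.mkAlg_surjective (K := K) Γ.ideal y
  rw [← one_mul (TwoSidedIdeal.mkAlg K Γ.ideal y)]
  refine PathAlgebra.mul_mem_of_generators (TwoSidedIdeal.mkAlg K Γ.ideal) _
    (fun x hx i => key _ (fun j => ?_) x hx) (fun x hx i j e => key _ (fun j => ?_) x hx) hone y
  · change _ * Γ.toAlg (idem K (i : Γ.E)) ∈ _
    -- a basis element that is a path is multiplied by an idempotent to itself or to zero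
    have path_mul : ∀ a b : Γ.E, ∀ x : PathAlgebra K Γ.QuiverVertex, x * idem K b = x →
        Γ.toAlg x ∈ Submodule.span K (Set.range Γ.basisElt) →
        Γ.toAlg x * Γ.toAlg (idem K a) ∈ Submodule.span K (Set.range Γ.basisElt) := by
      intro a b x hb hx
      by_cases hab : b = a
      · rwa [← map_mul, ← hab, hb]
      · have : idem K b * idem K a = 0 := PathAlgebra.vtx_mul_vtx_of_ne (V := Γ.QuiverVertex) hab
        rw [← map_mul, ← hb, mul_assoc, this, mul_zero, map_zero]
        exact Submodule.zero_mem _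
    rcases j with j | ⟨h, n⟩ | ⟨j, hj⟩
    · exact path_mul i j _ (PathAlgebra.vtx_mul_self (V := Γ.QuiverVertex) j) (mem (.inl j))
    · exact path_mul i _ _ (walk_mul_idem h n.1.succ_ne_zero) (mem (.inr (.inl ⟨h, n⟩)))
    · exact path_mul i _ _ (elt_mul_idem _) (mem (.inr (.inr ⟨j, hj⟩)))
  · rw [arr_eq_elt]
    change _ * Γ.toAlg (e.1.elt K) ∈ _
    generalize e.1 = a
    rcases j with j | ⟨h, n⟩ | ⟨j, hj⟩
    · change Γ.toAlg (idem K j) * _ ∈ _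
      by_cases hj : j = a.source
      · rw [← map_mul, hj, idem_mul_elt]
        exact elt_mem a
      · rw [← map_mul, idem_mul_elt_of_ne hj, map_zero]
        exact Submodule.zero_mem _
    · change Γ.toAlg (walk K h (n + 1)) * _ ∈ _
      rcases a with k | ⟨i, hi⟩
      · by_cases hk : k = Γ.next^[n + 1] h
        · rw [← map_mul, hk, ← walk_succ]
          exact walk_mem _ _ (Nat.succ_ne_zero _)
        · rw [← map_mul, toAlg_walk_mul_elt n.1.succ_ne_zero hk]
          exact Submodule.zero_mem _
      · rw [← map_mul, walk_succ, mul_assoc, elt_ofSucc_mul_loop, mul_zero, map_zero]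
        exact Submodule.zero_mem _
    · change Γ.toAlg ((Arrow.loop j hj).elt K) * _ ∈ _
      rcases a with k | ⟨i, hi⟩
      · rw [← map_mul, elt_loop_mul_ofSucc, map_zero]
        exact Submodule.zero_mem _
      · rw [← map_mul, toAlg_loop_mul_loop]
        exact Submodule.zero_mem _

variable {Γ}

/-- An element of a Brauer graph algebra commutes with everything if it commutes with the
idempotents of the edges and is annihilated by the arrows on both sides. -/
theorem commute_of_mul_elt_eq_zero {z : Γ.Alg} (hi : ∀ i : Γ.E, Commute z (Γ.toAlg (idem K i)))
    (hr : ∀ a : Γ.Arrow, z * Γ.toAlg (a.elt K) = 0) (hl : ∀ a : Γ.Arrow, Γ.toAlg (a.elt K) * z = 0)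
    (y : Γ.Alg) : Commute z y := by
  obtain ⟨y, rfl⟩ := TwoSidedIdeal.mkAlg_surjective (K := K) Γ.ideal y
  refine PathAlgebra.commute_of_generators (TwoSidedIdeal.mkAlg K Γ.ideal) hi (fun i j e => ?_) y
  rw [arr_eq_elt]
  exact (hr e.1).trans (hl e.1).symm

theorem toAlg_walk_len_mul_elt (h : Γ.NonTrunc) (a : Γ.Arrow) :
    Γ.toAlg (walk K h (len h.1) * a.elt K) = 0 := by
  have hl := (len_pos h.1).ne'
  rcases a with k | ⟨i, hi⟩
  · by_cases hk : k = h
    · subst hk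
      have := toAlg_walk_len_succ k
      rwa [walk_succ, next_iterate_len] at this
    · exact toAlg_walk_mul_elt hl (by rwa [next_iterate_len])
  · obtain ⟨n, hn⟩ := Nat.exists_eq_succ_of_ne_zero hl
    rw [hn, Nat.succ_eq_add_one, walk_succ, mul_assoc, elt_ofSucc_mul_loop, mul_zero, map_zero]

theorem commute_walk_len (h : Γ.NonTrunc) (y : Γ.Alg) :
    Commute (Γ.toAlg (walk K h (len h.1))) y := by
  have hl := (len_pos h.1).ne'
  refine commute_of_mul_elt_eq_zero (fun i => ?_) (fun a => ?_) (fun a => ?_) y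
  · refine (map_mul Γ.toAlg _ _).symm.trans (Eq.trans (congrArg _ ?_) (map_mul Γ.toAlg _ _))
    by_cases hi : i = Γ.edge h
    · have := walk_mul_idem (K := K) h hl
      rw [next_iterate_len] at this
      rw [hi, this, idem_mul_walk h hl]
    · rw [idem_mul_walk_of_ne hi hl, walk_mul_idem_of_ne h hl]
      rw [next_iterate_len]
      exact Ne.symm hi
  · rw [← map_mul, toAlg_walk_len_mul_elt]
  · rw [← map_mul]
    rcases a with k | ⟨i, hi⟩
    · by_cases hk : Γ.next k = h
      · subst hk
        have := toAlg_walk_len_succ k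
        rwa [walk_succ', ← len_next_iterate k 1] at this
      · rw [← walk_one]
        exact toAlg_walk_mul_walk one_ne_zero hl (Ne.symm hk)
    · obtain ⟨n, hn⟩ := Nat.exists_eq_succ_of_ne_zero hl
      rw [hn, Nat.succ_eq_add_one, walk_succ', ← mul_assoc, elt_loop_mul_ofSucc, zero_mul, map_zero]

theorem commute_loop {i : Γ.E} (hi : ∀ h, Γ.edge h = i → Γ.IsTruncated h) (y : Γ.Alg) :
    Commute (Γ.toAlg ((Arrow.loop i hi).elt K)) y := by
  refine commute_of_mul_elt_eq_zero (fun j => ?_) (fun a => ?_) (fun a => ?_) y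
  · refine (map_mul Γ.toAlg _ _).symm.trans (Eq.trans (congrArg _ ?_) (map_mul Γ.toAlg _ _))
    by_cases hj : i = j
    · subst hj
      exact (elt_mul_idem (K := K) (Arrow.loop i hi)).trans (idem_mul_elt (Arrow.loop i hi)).symm
    · rw [elt_mul_idem_of_ne (a := .loop i hi) hj, idem_mul_elt_of_ne (a := .loop i hi) (Ne.symm hj)]
  · rw [← map_mul]
    rcases a with k | ⟨j, hj⟩
    · rw [elt_loop_mul_ofSucc, map_zero]
    · exact toAlg_loop_mul_loop hi hj
  · rw [← map_mul]
    rcases a with k | ⟨j, hj⟩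
    · rw [elt_ofSucc_mul_loop, map_zero]
    · exact toAlg_loop_mul_loop hj hi

/-- An element that is annihilated by the arrows from the right is central. Pairing it, by means
of the socle form, with the complements in the socle of the paths of the standard basis shows that
it is a linear combination of the paths `C_{i, μ} ^ m(μ)` and of loops. -/
theorem commute_of_mul_arrows_eq_zero {x : Γ.Alg} (hx : ∀ a : Γ.Arrow, x * Γ.toAlg (a.elt K) = 0)
    (y : Γ.Alg) : Commute x y := by
  classical
  let _ : Fintype Γ.BasisIndex := Fintype.ofFinite _
  obtain ⟨ψ, hψ⟩ := Γ.exists_socleForm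
  have hmem : x ∈ Submodule.span K (Set.range Γ.basisElt) := by
    rw [span_basisElt]
    trivial
  obtain ⟨c, hc⟩ := (Submodule.mem_span_range_iff_exists_fun K).1 hmem
  have hwalk : ∀ (h : Γ.NonTrunc) (n : ℕ), n ≠ 0 → x * Γ.toAlg (walk K h n) = 0 := fun h n hn => by
    obtain ⟨n, rfl⟩ := Nat.exists_eq_succ_of_ne_zero hn
    rw [Nat.succ_eq_add_one, walk_succ', map_mul, ← mul_assoc, hx, zero_mul]
  -- a coefficient vanishes if some `z` with `x * z = 0` pairs only with the basis element
  have coeff : ∀ (j : Γ.BasisIndex) (z : Γ.Alg), x * z = 0 →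
      (∀ j', j' ≠ j → ψ (Γ.basisElt j' * z) = 0) → ψ (Γ.basisElt j * z) ≠ 0 → c j = 0 := by
    intro j z hz h0 h1
    have h2 : ψ (x * z) = ∑ j', c j' * ψ (Γ.basisElt j' * z) := by
      rw [← hc, Finset.sum_mul, map_sum]
      exact Finset.sum_congr rfl fun j' _ => by rw [smul_mul_assoc, map_smul, smul_eq_mul]
    rw [hz, map_zero, Finset.sum_eq_single j (fun j' _ hj' => by rw [h0 j' hj', mul_zero])
      (by simp)] at h2
    exact (mul_eq_zero.1 h2.symm).resolve_right h1
  have loop_walk : ∀ {i : Γ.E} (hi : ∀ h, Γ.edge h = i → Γ.IsTruncated h) (h : Γ.NonTrunc) {n : ℕ},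
      n ≠ 0 → Γ.toAlg ((Arrow.loop i hi).elt K) * Γ.toAlg (walk K h n) = 0 := by
    intro i hi h n hn
    obtain ⟨n, rfl⟩ := Nat.exists_eq_succ_of_ne_zero hn
    rw [Nat.succ_eq_add_one, walk_succ', ← map_mul, ← mul_assoc, elt_loop_mul_ofSucc, zero_mul,
      map_zero]
  -- the pairing of a path that is not an idempotent with the start of another path
  have walk_walk : ∀ (h k : Γ.NonTrunc) {m n : ℕ}, m ≠ 0 → n ≠ 0 →
      ψ (Γ.toAlg (walk K h m) * Γ.toAlg (walk K k n))
        = if k = Γ.next^[m] h ∧ m + n = len h.1 then Γ.socleCoeff h else 0 := by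
    intro h k m n hm hn
    rw [← map_mul]
    by_cases hk : k = Γ.next^[m] h
    · rw [hk, ← walk_add, hψ, pathForm_walk _ _ (by omega)]
      simp
    · rw [toAlg_walk_mul_walk hm hn hk, map_zero, if_neg (by tauto)]
  have idem_walk : ∀ (i : Γ.E) (h : Γ.NonTrunc) {n : ℕ}, n ≠ 0 →
      ψ (Γ.toAlg (idem K i) * Γ.toAlg (walk K h n))
        = if i = Γ.edge h ∧ n = len h.1 then Γ.socleCoeff h else 0 := by
    intro i h n hn
    rw [← map_mul, hψ]
    by_cases hi : i = Γ.edge h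
    · rw [hi, idem_mul_walk h hn, pathForm_walk _ _ hn]
      simp
    · rw [idem_mul_walk_of_ne hi hn, map_zero, if_neg (by tauto)]
  rw [← hc]
  refine Commute.sum_left _ _ _ fun j _ => ?_
  rcases j with i | ⟨h, n⟩ | ⟨i, hi⟩
  · rw [show c (.inl i) = 0 from ?_, zero_smul]
    · exact Commute.zero_left y
    by_cases hi : ∀ h, Γ.edge h = i → Γ.IsTruncated h
    · refine coeff _ _ (hx (.loop i hi)) ?_ ?_
      · rintro (i' | ⟨h', n'⟩ | ⟨i', hi'⟩) hj
        · change ψ (Γ.toAlg (idem K i') * _) = 0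
          rw [← map_mul, idem_mul_elt_of_ne (a := .loop i hi) (fun e => hj (congrArg _ e)), map_zero,
            map_zero]
        · change ψ (Γ.toAlg (walk K h' (n' + 1)) * _) = 0
          rw [← map_mul, walk_succ, mul_assoc, elt_ofSucc_mul_loop, mul_zero, map_zero, map_zero]
        · change ψ (Γ.toAlg ((Arrow.loop i' hi').elt K) * _) = 0
          rw [← map_mul, toAlg_loop_mul_loop, map_zero]
      · change ψ (Γ.toAlg (idem K (Arrow.loop i hi).source) * _) ≠ 0
        rw [← map_mul, idem_mul_elt, hψ, pathForm_loop]
        exact one_ne_zero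
    · push Not at hi
      obtain ⟨h, rfl, ht⟩ := hi
      have hl := (len_pos h).ne'
      refine coeff _ _ (hwalk ⟨h, ht⟩ (len h) hl) ?_ ?_
      · rintro (i' | ⟨h', n'⟩ | ⟨i', hi'⟩) hj
        · refine (idem_walk i' ⟨h, ht⟩ hl).trans (if_neg fun e => hj (congrArg _ e.1))
        · refine (walk_walk h' ⟨h, ht⟩ n'.1.succ_ne_zero hl).trans (if_neg fun e => ?_)
          have h1 := len_next_iterate h' (n'.1 + 1)
          rw [← e.1] at h1
          have h2 := e.2
          dsimp only at h1
          omega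
        · exact (congrArg ψ (loop_walk hi' ⟨h, ht⟩ hl)).trans (map_zero _)
      · refine (idem_walk _ ⟨h, ht⟩ hl).trans_ne ?_
        rw [if_pos ⟨rfl, rfl⟩]
        exact socleCoeff_ne_zero _ _
  · by_cases hn : n.1 + 1 = len h.1
    · refine Commute.smul_left ?_ _
      change Commute (Γ.toAlg (walk K h (n + 1))) y
      rw [hn]
      exact commute_walk_len h y
    · rw [show c (.inr (.inl ⟨h, n⟩)) = 0 from ?_, zero_smul]
      · exact Commute.zero_left y
      have hlt := n.2
      have hm : len h.1 - (n.1 + 1) ≠ 0 := by omega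
      have hk := len_next_iterate h (n.1 + 1)
      refine coeff _ _ (hwalk (Γ.next^[n.1 + 1] h) (len h.1 - (n.1 + 1)) hm) ?_ ?_
      · rintro (i' | ⟨h', n'⟩ | ⟨i', hi'⟩) hj
        · refine (idem_walk i' _ hm).trans (if_neg fun e => ?_)
          have := e.2
          omega
        · refine (walk_walk h' _ n'.1.succ_ne_zero hm).trans (if_neg fun e => ?_)
          have h1 := len_next_iterate h' (n'.1 + 1)
          have h2 := e.2
          have h3 : n'.1 = n.1 := by
            rw [← e.1] at h1
            omega
          have h4 : h' = h := by
            have h5 := e.1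
            rw [h3] at h5
            exact (next_injective.iterate _ h5).symm
          subst h4
          exact hj (congrArg (fun t => Sum.inr (Sum.inl (Sigma.mk h' t))) (Fin.ext h3))
        · exact (congrArg ψ (loop_walk hi' _ hm)).trans (map_zero _)
      · refine (walk_walk h _ n.1.succ_ne_zero hm).trans_ne ?_
        rw [if_pos ⟨rfl, by omega⟩]
        exact socleCoeff_ne_zero _ _
  · exact Commute.smul_left (commute_loop hi y) _

/-- In a Brauer graph algebra, every element that spans a right ideal is central. -/
theorem commute_of_mul_mem_span {x : Γ.Alg} (hx : ∀ y, ∃ c : K, x * y = c • x) (y : Γ.Alg) :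
    Commute x y := by
  by_cases h0 : x = 0
  · rw [h0]
    exact Commute.zero_left y
  refine commute_of_mul_arrows_eq_zero (fun a => ?_) y
  obtain ⟨c, hc⟩ := hx (Γ.toAlg (a.elt K))
  obtain ⟨n, hn⟩ := toAlg_elt_pow_eq_zero (K := K) a
  have hpow : ∀ n, x * Γ.toAlg (a.elt K) ^ n = c ^ n • x := fun n => by
    induction n with
    | zero => simp
    | succ n ih => rw [pow_succ, ← mul_assoc, ih, smul_mul_assoc, hc, smul_smul, pow_succ]
  have h1 := hpow n
  rw [hn, mul_zero] at h1
  rw [hc, IsNilpotent.eq_zero ⟨n, (smul_eq_zero.1 h1.symm).resolve_right h0⟩, zero_smul]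

end QuantizedBrauerGraph

/-! ### Lifting to the covering quiver -/

namespace CoveringQuiver

variable {K V G : Type*} [Field K] [Quiver V] [Group G] {ω : WeightFunction V G}

/-- The vertex `a_g` of the covering quiver. -/
abbrev mk (ω : WeightFunction V G) (a : V) (g : G) : CoveringQuiver ω := (a, g)

/-- The lift `a_g` of an arrow `a`. -/
def liftArrow (ω : WeightFunction V G) {a b : V} (e : a ⟶ b) (g : G) :
    mk ω a g ⟶ mk ω b (g * ω e) :=
  ⟨e, rfl⟩

theorem _root_.pathWeight_nil (ω : WeightFunction V G) (a : V) :
    pathWeight ω (Quiver.Path.nil : Quiver.Path a a) = 1 := by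
  simp [pathWeight]

theorem _root_.pathWeight_cons (ω : WeightFunction V G) {a b c : V} (p : Quiver.Path a b)
    (e : b ⟶ c) : pathWeight ω (p.cons e) = pathWeight ω p * ω e :=
  Quiver.Path.weight_cons _ p e

theorem exists_liftPath (ω : WeightFunction V G) {a b : V} (p : Quiver.Path a b) (g g' : G)
    (hg : g' = g * pathWeight ω p) :
    ∃ q : Quiver.Path (mk ω a g) (mk ω b g'), (proj ω).mapPath q = p := by
  induction p generalizing g' with
  | nil =>
    obtain rfl : g' = g := by rw [hg, pathWeight_nil, mul_one]
    exact ⟨.nil, rfl⟩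
  | cons p e ih =>
    obtain ⟨q, hq⟩ := ih _ rfl
    refine ⟨q.cons ⟨e, ?_⟩, ?_⟩
    · rw [hg, pathWeight_cons, mul_assoc]
    · rw [Prefunctor.mapPath_cons, hq]
      rfl

/-- The idempotent of the path algebra of the covering quiver at the vertex `a_g`. -/
noncomputable def vtx (K : Type*) [Field K] (ω : WeightFunction V G) (a : V) (g : G) :
    PathAlgebra K (CoveringQuiver ω) :=
  PathAlgebra.vtx K (mk ω a g)

/-- The lift of an arrow, as an element of the path algebra of the covering quiver. -/
noncomputable def arr (K : Type*) [Field K] (ω : WeightFunction V G) {a b : V} (e : a ⟶ b) (g : G) :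
    PathAlgebra K (CoveringQuiver ω) :=
  PathAlgebra.arr K (liftArrow ω e g)

theorem arr_eq_of_eq {a b : V} {g g' : G} (e : a ⟶ b) (he : g' = g * ω e) :
    PathAlgebra.arr K (show mk ω a g ⟶ mk ω b g' from ⟨e, he⟩) = arr K ω e g := by
  subst he
  rfl

theorem arr_eq {x y : CoveringQuiver ω} (e : x ⟶ y) : PathAlgebra.arr K e = arr K ω e.1 x.2 :=
  arr_eq_of_eq e.1 e.2

variable [Fintype V] [Fintype G]

theorem vtx_mul_arr {a b : V} (e : a ⟶ b) (g : G) : vtx K ω a g * arr K ω e g = arr K ω e g :=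
  PathAlgebra.vtx_mul_arr (liftArrow ω e g)

theorem arr_mul_vtx {a b : V} (e : a ⟶ b) (g : G) :
    arr K ω e g * vtx K ω b (g * ω e) = arr K ω e g :=
  PathAlgebra.arr_mul_vtx (liftArrow ω e g)

theorem vtx_mul_vtx_of_ne {a b : V} {g g' : G} (h : ¬ (a = b ∧ g = g')) :
    vtx K ω a g * vtx K ω b g' = 0 :=
  PathAlgebra.vtx_mul_vtx_of_ne (V := CoveringQuiver ω) fun e => h (Prod.ext_iff.1 e)

theorem vtx_mul_vtx (a : V) (g : G) : vtx K ω a g * vtx K ω a g = vtx K ω a g :=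
  PathAlgebra.vtx_mul_self (V := CoveringQuiver ω) _

theorem sum_vtx : ∑ a, ∑ g, vtx K ω a g = 1 := by
  rw [← PathAlgebra.sum_vtx (V := CoveringQuiver ω)]
  exact (Fintype.sum_prod_type' fun a g => vtx K ω a g).symm

theorem vtx_mul_sum_vtx (a : V) (g : G) : vtx K ω a g * ∑ g', vtx K ω a g' = vtx K ω a g := by
  rw [Finset.mul_sum, Finset.sum_eq_single g (fun g' _ h => vtx_mul_vtx_of_ne (by tauto)) (by simp),
    vtx_mul_vtx]

theorem sum_vtx_mul_vtx (a : V) (g : G) : (∑ g', vtx K ω a g') * vtx K ω a g = vtx K ω a g := by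
  rw [Finset.sum_mul, Finset.sum_eq_single g (fun g' _ h => vtx_mul_vtx_of_ne (by tauto)) (by simp),
    vtx_mul_vtx]

theorem vtx_mul_sum_vtx_of_ne {a b : V} (h : a ≠ b) (g : G) :
    vtx K ω a g * ∑ g', vtx K ω b g' = 0 := by
  rw [Finset.mul_sum]
  exact Finset.sum_eq_zero fun g' _ => vtx_mul_vtx_of_ne (by tauto)

theorem vtx_mul_sum_arr {a b : V} (e : a ⟶ b) (g : G) :
    vtx K ω a g * ∑ g', arr K ω e g' = arr K ω e g := by
  rw [Finset.mul_sum, Finset.sum_eq_single g ?_ (by simp), vtx_mul_arr]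
  intro g' _ h
  rw [← vtx_mul_arr e g', ← mul_assoc, vtx_mul_vtx_of_ne (by tauto), zero_mul]

/-- The data of the homomorphism `liftHom`. -/
noncomputable def liftHomData (K : Type*) [Field K] (ω : WeightFunction V G) :
    PathAlgebra.LiftData V (PathAlgebra K (CoveringQuiver ω)) where
  vtx a := ∑ g, vtx K ω a g
  arr _ _ e := ∑ g, arr K ω e g
  sum_vtx := sum_vtx
  idem a := by
    rw [Finset.sum_mul]
    exact Finset.sum_congr rfl fun g _ => vtx_mul_sum_vtx a g
  orth a b h := by
    rw [Finset.sum_mul]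
    exact Finset.sum_eq_zero fun g _ => vtx_mul_sum_vtx_of_ne h g
  vtx_mul_arr a b e := by
    rw [Finset.mul_sum]
    refine Finset.sum_congr rfl fun g _ => ?_
    rw [← vtx_mul_arr, ← mul_assoc, sum_vtx_mul_vtx]
  arr_mul_vtx a b e := by
    rw [Finset.sum_mul]
    refine Finset.sum_congr rfl fun g _ => ?_
    rw [← arr_mul_vtx, mul_assoc, vtx_mul_sum_vtx]

/-- The homomorphism from the path algebra of a quiver to the path algebra of its covering quiver
that maps a path to the sum of its lifts. -/
noncomputable def liftHom (K : Type*) [Field K] (ω : WeightFunction V G) :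
    PathAlgebra K V →ₐ[K] PathAlgebra K (CoveringQuiver ω) :=
  (liftHomData K ω).lift K

theorem vtx_mul_liftHom_vtx (a : V) (g : G) :
    vtx K ω a g * liftHom K ω (PathAlgebra.vtx K a) = vtx K ω a g := by
  rw [liftHom, PathAlgebra.LiftData.lift_vtx]
  exact vtx_mul_sum_vtx a g

theorem vtx_mul_liftHom_vtx_of_ne {a b : V} (h : a ≠ b) (g : G) :
    vtx K ω a g * liftHom K ω (PathAlgebra.vtx K b) = 0 := by
  rw [liftHom, PathAlgebra.LiftData.lift_vtx]
  exact vtx_mul_sum_vtx_of_ne h g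

theorem liftHom_vtx_mul_vtx (a : V) (g : G) :
    liftHom K ω (PathAlgebra.vtx K a) * vtx K ω a g = vtx K ω a g := by
  rw [liftHom, PathAlgebra.LiftData.lift_vtx]
  exact sum_vtx_mul_vtx a g

theorem vtx_mul_liftHom_arr {a b : V} (e : a ⟶ b) (g : G) :
    vtx K ω a g * liftHom K ω (PathAlgebra.arr K e) = arr K ω e g := by
  rw [liftHom, PathAlgebra.LiftData.lift_arr]
  exact vtx_mul_sum_arr e g

theorem vtx_mul_liftHom_mapPath {x y : CoveringQuiver ω} (q : Quiver.Path x y) :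
    PathAlgebra.vtx K x * liftHom K ω (PathAlgebra.ofPath K ((proj ω).mapPath q))
      = PathAlgebra.ofPath K q := by
  induction q with
  | nil => exact vtx_mul_liftHom_vtx x.1 x.2
  | @cons y z q e ih =>
    have h := vtx_mul_liftHom_arr (K := K) (ω := ω) e.1 y.2
    rw [← arr_eq] at h
    rw [PathAlgebra.ofPath_cons, ← h, ← PathAlgebra.ofPath_mul_vtx q, ← ih, Prefunctor.mapPath_cons,
      PathAlgebra.ofPath_cons, map_mul]
    rw [mul_assoc _ (PathAlgebra.vtx K y) _, ← mul_assoc (PathAlgebra.vtx K y) (vtx K ω y.1 y.2)]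
    rw [show PathAlgebra.vtx K y * vtx K ω y.1 y.2 = PathAlgebra.vtx K y from
      PathAlgebra.vtx_mul_self y, ← mul_assoc, ih, ← mul_assoc, PathAlgebra.ofPath_mul_vtx]
    rfl

/-- A uniform element of the path algebra of the covering quiver can be recovered from its image
under the projection. -/
theorem vtx_mul_liftHom_mul_vtx {x y : CoveringQuiver ω} (f : Quiver.Path x y →₀ K) :
    PathAlgebra.vtx K x * liftHom K ω (PathAlgebra.uniform ((proj ω).obj x) ((proj ω).obj y)
      (f.mapDomain fun p => (proj ω).mapPath p)) * PathAlgebra.vtx K y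
      = PathAlgebra.uniform x y f := by
  induction f using Finsupp.induction_linear with
  | zero => simp only [Finsupp.mapDomain_zero, ← PathAlgebra.uniformHom_apply, map_zero, mul_zero,
      zero_mul]
  | add f f' h h' =>
    simp only [← PathAlgebra.uniformHom_apply] at h h' ⊢
    rw [Finsupp.mapDomain_add, map_add, map_add, map_add, mul_add, add_mul, h, h']
  | single q c =>
    rw [Finsupp.mapDomain_single, PathAlgebra.uniform_single, PathAlgebra.uniform_single, map_smul,
      mul_smul_comm, smul_mul_assoc, vtx_mul_liftHom_mapPath, PathAlgebra.ofPath_mul_vtx]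

theorem uniform_mem_ideal {I : TwoSidedIdeal (PathAlgebra K V)} {x y : CoveringQuiver ω}
    {f : Quiver.Path x y →₀ K}
    (h : PathAlgebra.uniform ((proj ω).obj x) ((proj ω).obj y)
      (f.mapDomain fun p => (proj ω).mapPath p) ∈ I) :
    PathAlgebra.uniform x y f ∈ ideal ω I :=
  TwoSidedIdeal.subset_span ⟨x, y, f, rfl, h⟩

/-- All paths that occur in `x` have weight `γ`. -/
def HasWeight (ω : WeightFunction V G) (γ : G) (x : PathAlgebra K V) : Prop :=
  ∀ (a b : V), ∀ p ∈ (x a b).support, pathWeight ω p = γ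

/-- The sum of the lifts of a homogeneous element of an ideal belongs to the lifted ideal. -/
theorem liftHom_mem_ideal {I : TwoSidedIdeal (PathAlgebra K V)} {r : PathAlgebra K V} (hr : r ∈ I)
    {γ : G} (hγ : HasWeight ω γ r) : liftHom K ω r ∈ ideal ω I := by
  have hdec : liftHom K ω r = ∑ x : CoveringQuiver ω, ∑ y : CoveringQuiver ω,
      PathAlgebra.vtx K x * liftHom K ω r * PathAlgebra.vtx K y := by
    simp only [← Finset.mul_sum, ← Finset.sum_mul, PathAlgebra.sum_vtx, one_mul, mul_one]
  rw [hdec]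
  refine sum_mem fun x _ => sum_mem fun y _ => ?_
  have hcomp : PathAlgebra.vtx K x.1 * r * PathAlgebra.vtx K y.1
      = PathAlgebra.uniform x.1 y.1 (r x.1 y.1) := by
    conv_lhs => rw [PathAlgebra.eq_sum_uniform r]
    simp only [Finset.mul_sum, Finset.sum_mul]
    rw [Finset.sum_eq_single x.1, Finset.sum_eq_single y.1, PathAlgebra.vtx_mul_uniform,
      PathAlgebra.uniform_mul_vtx]
    · intro b _ hb
      rw [mul_assoc, PathAlgebra.vtx, PathAlgebra.vtx, PathAlgebra.ofPath, PathAlgebra.ofPath,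
        PathAlgebra.uniform_mul_uniform_of_ne hb, mul_zero]
    · simp
    · intro a _ ha
      refine Finset.sum_eq_zero fun b _ => ?_
      rw [PathAlgebra.vtx, PathAlgebra.vtx, PathAlgebra.ofPath, PathAlgebra.ofPath,
        PathAlgebra.uniform_mul_uniform_of_ne ha.symm, zero_mul]
    · simp
  have hmem : PathAlgebra.uniform x.1 y.1 (r x.1 y.1) ∈ I := by
    rw [← hcomp]
    exact I.mul_mem_right _ _ (I.mul_mem_left _ _ hr)
  have hx : PathAlgebra.vtx K x * liftHom K ω (PathAlgebra.vtx K x.1) = PathAlgebra.vtx K x :=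
    vtx_mul_liftHom_vtx x.1 x.2
  have hy : liftHom K ω (PathAlgebra.vtx K y.1) * PathAlgebra.vtx K y = PathAlgebra.vtx K y :=
    liftHom_vtx_mul_vtx y.1 y.2
  rw [← hx, ← hy, mul_assoc (PathAlgebra.vtx K x), ← map_mul, ← mul_assoc,
    mul_assoc (PathAlgebra.vtx K x), ← map_mul, hcomp]
  generalize hf : r x.1 y.1 = f
  rw [hf] at hmem
  have hw : ∀ p ∈ f.support, pathWeight ω p = γ := fun p hp => hγ _ _ p (hf ▸ hp)
  by_cases hxy : y.2 = x.2 * γ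
  · -- every path that occurs in `f` lifts to a path from `x` to `y`
    have hlift : ∀ p : f.support, ∃ q : Quiver.Path x y, (proj ω).mapPath q = p.1 := fun p =>
      exists_liftPath ω p.1 x.2 y.2 (by rw [hw _ p.2, hxy])
    choose l hl using hlift
    have hmap : (∑ p : f.support, Finsupp.single (l p) (f p)).mapDomain
        (fun p => (proj ω).mapPath p) = f := by
      rw [Finsupp.mapDomain_finsetSum]
      simp only [Finsupp.mapDomain_single, hl]
      exact (Finset.sum_coe_sort f.support fun p => Finsupp.single p (f p)).trans f.sum_single
    have h1 := vtx_mul_liftHom_mul_vtx (∑ p : f.support, Finsupp.single (l p) (f p))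
    rw [hmap] at h1
    rw [show PathAlgebra.vtx K x * liftHom K ω (PathAlgebra.uniform x.1 y.1 f) *
      PathAlgebra.vtx K y = _ from h1]
    refine uniform_mem_ideal ?_
    rw [hmap]
    exact hmem
  · rw [PathAlgebra.uniform_eq_sum, Finsupp.sum, map_sum, Finset.mul_sum, Finset.sum_mul]
    refine sum_mem fun p hp => ?_
    obtain ⟨q, hq⟩ := exists_liftPath ω p x.2 _ rfl
    have h1 := vtx_mul_liftHom_mapPath (K := K) q
    rw [hq] at h1
    rw [map_smul, mul_smul_comm, smul_mul_assoc]
    have h2 : PathAlgebra.ofPath K q * PathAlgebra.vtx K y = 0 :=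
      PathAlgebra.ofPath_mul_vtx_of_ne
        (fun e => hxy (by rw [← hw p hp]; exact (congrArg Prod.snd e).symm)) q
    rw [← h1] at h2
    rw [show PathAlgebra.vtx K x * liftHom K ω (PathAlgebra.ofPath K p) *
      PathAlgebra.vtx K y = 0 from h2, smul_zero]
    exact zero_mem _

/-- The data of the homomorphism `matrixHom`. -/
noncomputable def matrixHomData {A : Type*} [Ring A] [Algebra K A] (ω : WeightFunction V G)
    (f : PathAlgebra K V →ₐ[K] A) [DecidableEq G] :
    PathAlgebra.LiftData (CoveringQuiver ω) (Matrix G G A) where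
  vtx x := Matrix.single x.2 x.2 (f (PathAlgebra.vtx K x.1))
  arr x y e := Matrix.single x.2 y.2 (f (PathAlgebra.arr K e.1))
  sum_vtx := by
    refine (Fintype.sum_prod_type' fun a g =>
      Matrix.single g g (f (PathAlgebra.vtx K a))).trans ?_
    rw [Finset.sum_comm]
    ext g g'
    simp only [Matrix.sum_apply, Matrix.single_apply, Matrix.one_apply]
    by_cases h : g = g'
    · subst h
      simp [← map_sum, PathAlgebra.sum_vtx]
    · rw [if_neg h]
      refine Finset.sum_eq_zero fun k _ => Finset.sum_eq_zero fun a _ => if_neg ?_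
      rintro ⟨rfl, rfl⟩
      exact h rfl
  idem x := by rw [Matrix.single_mul_single_same, ← map_mul, PathAlgebra.vtx_mul_self]
  orth x y h := by
    by_cases e : x.2 = y.2
    · have h1 : x.1 ≠ y.1 := fun e' => h (Prod.ext e' e)
      rw [e, Matrix.single_mul_single_same, ← map_mul, PathAlgebra.vtx_mul_vtx_of_ne h1, map_zero,
        Matrix.single_zero]
    · exact Matrix.single_mul_single_of_ne _ _ _ _ e _
  vtx_mul_arr x y e := by
    rw [Matrix.single_mul_single_same, ← map_mul, PathAlgebra.vtx_mul_arr]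
  arr_mul_vtx x y e := by
    rw [Matrix.single_mul_single_same, ← map_mul, PathAlgebra.arr_mul_vtx]

/-- For a homomorphism `f` from the path algebra of a quiver to `A`, the homomorphism from the path
algebra of the covering quiver to the matrices over `A` with rows and columns indexed by `G` that
maps a path from `a_g` to `b_h` to the image under `f` of its projection at the position
`(g, h)`. -/
noncomputable def matrixHom {A : Type*} [Ring A] [Algebra K A] (ω : WeightFunction V G)
    (f : PathAlgebra K V →ₐ[K] A) [DecidableEq G] :
    PathAlgebra K (CoveringQuiver ω) →ₐ[K] Matrix G G A :=
  (matrixHomData ω f).lift K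

variable {A : Type*} [Ring A] [Algebra K A] [DecidableEq G]

theorem matrixHom_ofPath (f : PathAlgebra K V →ₐ[K] A) {x y : CoveringQuiver ω}
    (q : Quiver.Path x y) : matrixHom ω f (PathAlgebra.ofPath K q)
      = Matrix.single x.2 y.2 (f (PathAlgebra.ofPath K ((proj ω).mapPath q))) := by
  induction q with
  | nil => exact PathAlgebra.LiftData.lift_vtx _ _
  | @cons y z q e ih =>
    rw [PathAlgebra.ofPath_cons, map_mul, ih, Prefunctor.mapPath_cons, PathAlgebra.ofPath_cons,
      map_mul]
    refine (congrArg (_ * ·) (PathAlgebra.LiftData.lift_arr _ e)).trans ?_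
    exact Matrix.single_mul_single_same ..

theorem matrixHom_uniform (f : PathAlgebra K V →ₐ[K] A) {x y : CoveringQuiver ω}
    (r : Quiver.Path x y →₀ K) : matrixHom ω f (PathAlgebra.uniform x y r)
      = Matrix.single x.2 y.2 (f (PathAlgebra.uniform ((proj ω).obj x) ((proj ω).obj y)
          (r.mapDomain fun p => (proj ω).mapPath p))) := by
  induction r using Finsupp.induction_linear with
  | zero => simp only [Finsupp.mapDomain_zero, ← PathAlgebra.uniformHom_apply, map_zero,
      Matrix.single_zero]
  | add r r' h h' =>
    simp only [← PathAlgebra.uniformHom_apply] at h h' ⊢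
    rw [Finsupp.mapDomain_add, map_add, map_add, map_add, map_add, Matrix.single_add, h, h']
  | single q c =>
    rw [Finsupp.mapDomain_single, PathAlgebra.uniform_single, PathAlgebra.uniform_single, map_smul,
      map_smul, matrixHom_ofPath, Matrix.smul_single]

/-- The lifted ideal contains exactly those paths whose projections belong to the ideal. -/
theorem ofPath_mem_ideal_iff {I : TwoSidedIdeal (PathAlgebra K V)} {x y : CoveringQuiver ω}
    (q : Quiver.Path x y) :
    PathAlgebra.ofPath K q ∈ ideal ω I ↔ PathAlgebra.ofPath K ((proj ω).mapPath q) ∈ I := by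
  classical
  constructor
  · intro h
    have h0 : matrixHom ω (TwoSidedIdeal.mkAlg K I) (PathAlgebra.ofPath K q) = 0 := by
      refine TwoSidedIdeal.apply_eq_zero_of_mem_span _ ?_ h
      rintro _ ⟨a, b, f, rfl, hf⟩
      rw [matrixHom_uniform, (TwoSidedIdeal.mkAlg_eq_zero_iff I _).2 hf, Matrix.single_zero]
    rw [matrixHom_ofPath] at h0
    have h1 := congrFun (congrFun h0 x.2) y.2
    rw [Matrix.single_apply_same] at h1
    exact (TwoSidedIdeal.mkAlg_eq_zero_iff I _).1 h1
  · intro h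
    refine uniform_mem_ideal ?_
    rw [Finsupp.mapDomain_single]
    exact h

/-- A cycle of nontrivial weight that is nonzero modulo the ideal `I`, but whose products with
arrows from the right vanish, lifts to a non-central element of the covering algebra that spans a
right ideal. -/
theorem exists_not_commute {I : TwoSidedIdeal (PathAlgebra K V)} {a b : V} (p : Quiver.Path a b)
    (hp : PathAlgebra.ofPath K p ∉ I)
    (hpa : ∀ (c : V) (e : b ⟶ c), PathAlgebra.ofPath K (p.cons e) ∈ I) (hw : pathWeight ω p ≠ 1) :
    ∃ z : CoveringAlgebra ω I, (∀ y, ∃ c : K, z * y = c • z) ∧ ∃ y, ¬ Commute z y := by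
  obtain ⟨q, hqp⟩ := exists_liftPath ω p 1 (pathWeight ω p) (one_mul _).symm
  set m := TwoSidedIdeal.mkAlg K (ideal ω I)
  have hq : m (PathAlgebra.ofPath K q) ≠ 0 := fun h0 =>
    hp (hqp ▸ (ofPath_mem_ideal_iff q).1 ((TwoSidedIdeal.mkAlg_eq_zero_iff _ _).1 h0))
  refine ⟨m (PathAlgebra.ofPath K q), fun y => ?_, m (PathAlgebra.vtx K (mk ω a 1)), fun hcomm => ?_⟩
  · obtain ⟨y, rfl⟩ := TwoSidedIdeal.mkAlg_surjective (K := K) (ideal ω I) y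
    have := PathAlgebra.mul_mem_of_generators m (K ∙ m (PathAlgebra.ofPath K q)) ?_ ?_
      (Submodule.mem_span_singleton_self _) y
    · obtain ⟨c, hc⟩ := Submodule.mem_span_singleton.1 this
      exact ⟨c, hc.symm⟩
    · intro x hx v
      obtain ⟨c, rfl⟩ := Submodule.mem_span_singleton.1 hx
      rw [smul_mul_assoc, ← map_mul]
      refine Submodule.smul_mem _ c ?_
      by_cases h : mk ω b (pathWeight ω p) = v
      · rw [← h, PathAlgebra.ofPath_mul_vtx]
        exact Submodule.mem_span_singleton_self _
      · rw [PathAlgebra.ofPath_mul_vtx_of_ne h, map_zero]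
        exact Submodule.zero_mem _
    · intro x hx v v' e
      obtain ⟨c, rfl⟩ := Submodule.mem_span_singleton.1 hx
      rw [smul_mul_assoc, ← map_mul]
      refine Submodule.smul_mem _ c ?_
      by_cases h : mk ω b (pathWeight ω p) = v
      · subst h
        have h0 : PathAlgebra.ofPath K (q.cons e) ∈ ideal ω I := by
          refine (ofPath_mem_ideal_iff _).2 ?_
          rw [Prefunctor.mapPath_cons, hqp]
          exact hpa _ e.1
        rw [← PathAlgebra.ofPath_cons, (TwoSidedIdeal.mkAlg_eq_zero_iff (K := K) _ _).2 h0]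
        exact Submodule.zero_mem _
      · rw [PathAlgebra.arr, PathAlgebra.ofPath_mul_ofPath_of_ne h, map_zero]
        exact Submodule.zero_mem _
  · have h1 : mk ω b (pathWeight ω p) ≠ mk ω a 1 := fun e =>
      hw (congrArg Prod.snd e)
    have h2 := hcomm.eq
    rw [← map_mul, ← map_mul, PathAlgebra.ofPath_mul_vtx_of_ne h1, PathAlgebra.vtx_mul_ofPath,
      map_zero] at h2
    exact hq h2.symm

end CoveringQuiver

/-! ### Weights of walks -/

namespace BrauerGraph

variable {Γ : BrauerGraph.{u}} {K : Type v} [Field K] {G : Type w} [CommGroup G]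

/-- The product of the weights of a list of arrows. -/
def listWeight (ω : WeightFunction Γ.QuiverVertex G) (l : List Γ.Arrow) : G :=
  (l.map fun a => ω a.hom).prod

theorem listWeight_append (ω : WeightFunction Γ.QuiverVertex G) (l t : List Γ.Arrow) :
    listWeight ω (l ++ t) = listWeight ω l * listWeight ω t := by
  simp [listWeight]

theorem weight_hom {S : Type*} (ω : WeightFunction Γ.QuiverVertex S) {i j : Γ.QuiverVertex}
    (e : i ⟶ j) : ω e.1.hom = ω e := by
  obtain ⟨a, rfl, rfl⟩ := e
  rfl

theorem pathWeight_eq_listWeight (ω : WeightFunction Γ.QuiverVertex G) {i j : Γ.QuiverVertex}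
    (p : Quiver.Path i j) : pathWeight ω p = listWeight ω (pathList p) := by
  induction p with
  | nil => exact pathWeight_nil ω i
  | cons p e ih => simp [pathWeight_cons, ih, pathList, listWeight, weight_hom]

theorem IsMonomial.hasWeight {x : PathAlgebra K Γ.QuiverVertex} {l : List Γ.Arrow}
    (hx : IsMonomial x l) (ω : WeightFunction Γ.QuiverVertex G) :
    CoveringQuiver.HasWeight ω (listWeight ω l) x := by
  intro i j q hq
  obtain rfl | ⟨i', j', p, rfl, rfl⟩ := hx
  · simp at hq
  · by_cases h : i = i' ∧ j = j'
    · obtain ⟨rfl, rfl⟩ := h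
      rw [PathAlgebra.ofPath, PathAlgebra.uniform_apply_same] at hq
      rw [Finset.mem_singleton.1 (Finsupp.support_single_subset hq), pathWeight_eq_listWeight]
    · rw [PathAlgebra.ofPath, PathAlgebra.uniform_apply_of_ne _ h] at hq
      simp at hq

theorem walkList_add (h : Γ.NonTrunc) (m n : ℕ) :
    walkList h (m + n) = walkList h m ++ walkList (Γ.next^[m] h) n := by
  induction n with
  | zero => simp [walkList]
  | succ n ih =>
    rw [← add_assoc, walkList_succ, ih, walkList_succ, List.append_assoc, add_comm m n,
      Function.iterate_add_apply]

theorem listWeight_walkList_len (ω : WeightFunction Γ.QuiverVertex G) (h : Γ.NonTrunc) :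
    listWeight ω (walkList h (len h.1)) = Γ.cyclePowWeight ω h := by
  rw [len, cyclePowWeight]
  change _ = listWeight ω (walkList h (Γ.val (Γ.vert h))) ^ _
  generalize Γ.mult (Γ.vert h) = k
  induction k with
  | zero => rw [mul_zero, pow_zero]; rfl
  | succ k ih => rw [mul_add, mul_one, walkList_add, listWeight_append, ih, next_iterate_val_mul,
      pow_succ]

theorem listWeight_walkList (W : Γ.SuccessorWeighting G) (h : Γ.NonTrunc) (n : ℕ) :
    listWeight (arrowWeight W) (walkList h n) = ∏ k ∈ Finset.range n, W (Γ.succ^[k] h) := by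
  induction n with
  | zero => rfl
  | succ n ih =>
    rw [walkList_succ, listWeight_append, ih, Finset.prod_range_succ, ← coe_next_iterate]
    congr 1
    simp [listWeight]
    rfl

theorem prod_range_val (W : Γ.SuccessorWeighting G) (h : Γ.H) :
    ∏ k ∈ Finset.range (Γ.val (Γ.vert h)), W (Γ.succ^[k] h) = vertexWeight W (Γ.vert h) := by
  classical
  have hp := Function.minimalPeriod_pos_of_mem_periodicPts (mem_periodicPts_succ h)
  rw [val_vert]
  unfold vertexWeight
  refine Finset.prod_bij (fun k _ => Γ.succ^[k] h) ?_ ?_ ?_ fun _ _ => rfl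
  · intro k _
    simp only [Finset.mem_filter, Finset.mem_univ, true_and]
    exact ((Γ.vert_eq_iff _ _).2 ⟨k, by rw [zpow_natCast, Equiv.Perm.coe_pow]⟩).symm
  · intro a ha b hb hab
    exact Function.iterate_injOn_Iio_minimalPeriod (by simpa using ha) (by simpa using hb) hab
  · intro k hk
    simp only [Finset.mem_filter, Finset.mem_univ, true_and] at hk
    obtain ⟨n, hn⟩ := ((Γ.vert_eq_iff _ _).1 hk.symm).exists_nat_pow_eq
    refine ⟨n % Function.minimalPeriod Γ.succ h, Finset.mem_range.2 (Nat.mod_lt _ hp), ?_⟩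
    rw [Function.iterate_mod_minimalPeriod_eq, ← Equiv.Perm.coe_pow, hn]

theorem cyclePowWeight_arrowWeight (W : Γ.SuccessorWeighting G) (h : Γ.NonTrunc) :
    Γ.cyclePowWeight (arrowWeight W) h = vertexWeight W (Γ.vert h) ^ Γ.mult (Γ.vert h) := by
  rw [← prod_range_val, ← listWeight_walkList]
  rfl

theorem cyclePowWeight_eq_one {W : Γ.SuccessorWeighting G} (hW : IsBrauerWeighting W)
    (h : Γ.NonTrunc) : Γ.cyclePowWeight (arrowWeight W) h = 1 := by
  rw [cyclePowWeight_arrowWeight]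
  exact orderOf_dvd_iff_pow_eq_one.1 (hW _)

end BrauerGraph

namespace QuantizedBrauerGraph

open BrauerGraph

variable {K : Type v} [Field K] {G : Type w} [CommGroup G]

/-- If the paths `C_{i, μ} ^ m(μ)` have weight `1`, then the relations are homogeneous. -/
theorem exists_hasWeight_of_relation {Γ : QuantizedBrauerGraph.{u, v} K}
    {ω : WeightFunction Γ.QuiverVertex G} (hω : ∀ h, Γ.cyclePowWeight ω h = 1)
    {x : PathAlgebra K Γ.QuiverVertex} (hx : Γ.Relation x) :
    ∃ γ, CoveringQuiver.HasWeight ω γ x := by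
  cases hx with
  | one h hμ hν =>
    refine ⟨1, ?_⟩
    have key : ∀ k : Γ.NonTrunc, CoveringQuiver.HasWeight ω 1 (walk K k (len k.1)) := fun k => by
      rw [← hω k, ← listWeight_walkList_len]
      exact (isMonomial_walk k (len_pos _).ne').hasWeight ω
    rw [cycle_pow_mult (⟨h, hμ⟩ : Γ.NonTrunc), cycle_pow_mult (⟨Γ.opp h, hν⟩ : Γ.NonTrunc)]
    intro i j p hp
    classical
    rcases Finset.mem_union.1 (Finsupp.support_sub hp) with hp | hp
    · exact key _ i j p (Finsupp.support_smul hp)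
    · exact key _ i j p (Finsupp.support_smul hp)
  | two h hμ =>
    refine ⟨_, IsMonomial.hasWeight (l := walkList h (len h.1) ++ [.ofSucc h]) ?_ ω⟩
    rw [cycle_pow_mult]
    exact (isMonomial_walk h (len_pos _).ne').mul (isMonomial_elt _)
  | three h k hk hne => exact ⟨_, ((isMonomial_elt _).mul (isMonomial_elt _)).hasWeight ω⟩
  | square i hi =>
    rw [pow_two]
    exact ⟨_, ((isMonomial_elt _).mul (isMonomial_elt _)).hasWeight ω⟩

theorem isGeneratedByHomogeneous {Γ : QuantizedBrauerGraph.{u, v} K}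
    {ω : WeightFunction Γ.QuiverVertex G} (hω : ∀ h, Γ.cyclePowWeight ω h = 1) :
    IsGeneratedByHomogeneous ω Γ.ideal :=
  ⟨_, fun _ hx => exists_hasWeight_of_relation hω hx, rfl⟩

/-- If some path `C_{i, μ} ^ m(μ)` has a nontrivial weight, then the covering algebra is not
isomorphic to a Brauer graph algebra: its lift spans a right ideal without being central. -/
theorem isEmpty_coveringAlgebra_algEquiv [Fintype G] (Δ : QuantizedBrauerGraph.{u, v} K)
    (ω : WeightFunction Δ.QuiverVertex G) {h : Δ.NonTrunc} (hw : Δ.cyclePowWeight ω h ≠ 1)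
    (Γ : QuantizedBrauerGraph.{x, v} K) : IsEmpty (CoveringAlgebra ω Δ.ideal ≃ₐ[K] Γ.Alg) := by
  classical
  have hl := (len_pos h.1).ne'
  obtain ⟨i, j, p, hp, hpl⟩ := exists_path_walk (K := K) h hl
  obtain ⟨z, hz, y, hzy⟩ := CoveringQuiver.exists_not_commute (ω := ω) (I := Δ.ideal) p
    (fun hmem => Δ.toAlg_walk_len_ne_zero h (by rwa [← hp, toAlg_eq_zero_iff]))
    (fun c e => by
      rw [← toAlg_eq_zero_iff, PathAlgebra.ofPath_cons, arr_eq_elt, hp]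
      exact toAlg_walk_len_mul_elt h e.1)
    (by rwa [pathWeight_eq_listWeight, hpl, listWeight_walkList_len])
  refine ⟨fun f => hzy ?_⟩
  have h1 : Commute (f z) (f y) := commute_of_mul_mem_span (fun b => by
    obtain ⟨c, hc⟩ := hz (f.symm b)
    refine ⟨c, ?_⟩
    rw [← map_smul, ← hc, map_mul, AlgEquiv.apply_symm_apply]) _
  exact f.injective (by rw [map_mul, map_mul, h1.eq])

end QuantizedBrauerGraph

/-! ### The quiver of a Brauer covering graph -/

namespace BrauerGraph

section Length

variable {Γ : BrauerGraph.{u}} {G : Type w} [CommGroup G]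

theorem prod_range_val_mul (W : Γ.SuccessorWeighting G) (h : Γ.H) (n : ℕ) :
    ∏ k ∈ Finset.range (Γ.val (Γ.vert h) * n), W (Γ.succ^[k] h) = vertexWeight W (Γ.vert h) ^ n := by
  induction n with
  | zero => simp
  | succ n ih =>
    rw [mul_add, mul_one, Finset.prod_range_add, ih, pow_succ, ← prod_range_val]
    congr 1
    refine Finset.prod_congr rfl fun k _ => ?_
    rw [add_comm, Function.iterate_add_apply, (succ_iterate_eq_self_iff h _).2 (dvd_mul_right _ _)]

theorem coverSucc_iterate (W : Γ.SuccessorWeighting G) (n : ℕ) (h : Γ.H) (g : G) :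
    (coverSucc W)^[n] (h, g)
      = (Γ.succ^[n] h, g * ∏ k ∈ Finset.range n, W (Γ.succ^[k] h)) := by
  simpa only [Equiv.Perm.coe_pow] using coverSucc_pow W n h g

variable [Fintype G]

theorem val_cover (W : Γ.SuccessorWeighting G) (hW : IsBrauerWeighting W) (h : Γ.H) (g : G) :
    (Γ.cover W hW).val ((Γ.cover W hW).vert (h, g))
      = Γ.val (Γ.vert h) * orderOf (vertexWeight W (Γ.vert h)) := by
  have key : ∀ n, (Γ.cover W hW).val ((Γ.cover W hW).vert (h, g)) ∣ n ↔
      Γ.val (Γ.vert h) * orderOf (vertexWeight W (Γ.vert h)) ∣ n := fun n => by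
    refine (succ_iterate_eq_self_iff (Γ := Γ.cover W hW) (h, g) n).symm.trans ?_
    change (coverSucc W)^[n] (h, g) = (h, g) ↔ _
    rw [coverSucc_iterate, Prod.ext_iff]
    dsimp only
    rw [mul_eq_left, succ_iterate_eq_self_iff]
    constructor
    · rintro ⟨⟨k, rfl⟩, h2⟩
      rw [prod_range_val_mul] at h2
      exact Nat.mul_dvd_mul_left _ (orderOf_dvd_of_pow_eq_one h2)
    · rintro ⟨k, rfl⟩
      rw [mul_assoc]
      refine ⟨dvd_mul_right _ _, ?_⟩
      rw [prod_range_val_mul, pow_mul, pow_orderOf_eq_one, one_pow]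
  exact Nat.dvd_antisymm ((key _).2 dvd_rfl) ((key _).1 dvd_rfl)

/-- The order of `μ` by which the valency grows is the factor by which the multiplicity drops. -/
theorem len_cover (W : Γ.SuccessorWeighting G) (hW : IsBrauerWeighting W) (h : Γ.H) (g : G) :
    len (Γ := Γ.cover W hW) (h, g) = len h := by
  refine (congrArg (· * _) (val_cover W hW h g)).trans ?_
  rw [len, mul_assoc]
  exact congrArg _ (Nat.mul_div_cancel' (hW _))

theorem isTruncated_cover_iff (W : Γ.SuccessorWeighting G) (hW : IsBrauerWeighting W) (h : Γ.H)
    (g : G) : (Γ.cover W hW).IsTruncated (h, g) ↔ Γ.IsTruncated h :=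
  (isTruncated_iff_len (Γ := Γ.cover W hW) (h, g)).trans
    ((iff_of_eq (congrArg (· = 1) (len_cover W hW h g))).trans (isTruncated_iff_len h).symm)

end Length

variable {Γ : BrauerGraph.{u}} {K : Type v} [Field K] {G : Type w} [CommGroup G]
  (W : Γ.SuccessorWeighting G)

/-- The element of the path algebra of the covering quiver given by an arrow of the quiver of the
covering graph. -/
noncomputable def coveringArr (K : Type v) [Field K] (x : Γ.Arrow × G) :
    PathAlgebra K (CoveringQuiver (arrowWeight W)) :=
  CoveringQuiver.arr K (arrowWeight W) x.1.hom x.2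

theorem coveringArr_eq {i j : Γ.QuiverVertex} (e : i ⟶ j) (g : G) :
    CoveringQuiver.arr K (arrowWeight W) e g = coveringArr W K (e.1, g) := by
  obtain ⟨a, rfl, rfl⟩ := e
  rfl

variable [Fintype G] (hW : IsBrauerWeighting W)

/-- The half-edge of the covering graph over a half-edge that is not truncated. -/
def coverNT (h : Γ.NonTrunc) (g : G) : (Γ.cover W hW).NonTrunc :=
  ⟨(h.1, g), fun ht => h.2 ((isTruncated_cover_iff W hW _ _).1 ht)⟩

/-- The half-edge below a half-edge of the covering graph that is not truncated. -/
def baseNT (h : (Γ.cover W hW).NonTrunc) : Γ.NonTrunc :=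
  ⟨h.1.1, fun ht => h.2 ((isTruncated_cover_iff W hW _ _).2 ht)⟩

theorem loop_cover {i : Γ.E} (hi : ∀ h, Γ.edge h = i → Γ.IsTruncated h) (g : G) :
    ∀ h, (Γ.cover W hW).edge h = (i, g) → (Γ.cover W hW).IsTruncated h := fun h e =>
  (isTruncated_cover_iff W hW h.1 h.2).2 (hi h.1 (congrArg Prod.fst e))

theorem loop_base {x : (Γ.cover W hW).E}
    (hx : ∀ h, (Γ.cover W hW).edge h = x → (Γ.cover W hW).IsTruncated h) :
    ∀ h, Γ.edge h = x.1 → Γ.IsTruncated h := fun h e =>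
  (isTruncated_cover_iff W hW h x.2).1 (hx (h, x.2) (Prod.ext e rfl))

/-- The lift of an arrow of the quiver of `Γ`, as an arrow of the quiver of the covering graph. -/
def coverArrow : Γ.Arrow → G → (Γ.cover W hW).Arrow
  | .ofSucc h, g => .ofSucc (coverNT W hW h g)
  | .loop i hi, g => .loop (i, g) (loop_cover W hW hi g)

/-- The arrow below an arrow of the quiver of the covering graph. -/
def baseArrow : (Γ.cover W hW).Arrow → Γ.Arrow × G
  | .ofSucc h => (.ofSucc (baseNT W hW h), h.1.2)
  | .loop x hx => (.loop x.1 (loop_base W hW hx), x.2)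

theorem coverArrow_baseArrow (a : (Γ.cover W hW).Arrow) :
    coverArrow W hW (baseArrow W hW a).1 (baseArrow W hW a).2 = a := by
  cases a <;> rfl

theorem baseArrow_coverArrow (a : Γ.Arrow) (g : G) :
    baseArrow W hW (coverArrow W hW a g) = (a, g) := by
  cases a <;> rfl

theorem source_coverArrow (a : Γ.Arrow) (g : G) : (coverArrow W hW a g).source = (a.source, g) := by
  cases a <;> rfl

theorem target_coverArrow (a : Γ.Arrow) (g : G) :
    (coverArrow W hW a g).target = (a.target, g * arrowWeight W a.hom) := by
  cases a
  · rfl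
  · exact Prod.ext rfl (mul_one g).symm

/-- The data of the homomorphism `toCovering`. -/
noncomputable def toCoveringData (K : Type v) [Field K] :
    PathAlgebra.LiftData (Γ.cover W hW).QuiverVertex
      (PathAlgebra K (CoveringQuiver (arrowWeight W))) where
  vtx x := CoveringQuiver.vtx K (arrowWeight W) (x.1 : Γ.E) x.2
  arr x y e := coveringArr W K (baseArrow W hW e.1)
  sum_vtx := PathAlgebra.sum_vtx (V := CoveringQuiver (arrowWeight W))
  idem x := CoveringQuiver.vtx_mul_vtx _ _
  orth x y h := CoveringQuiver.vtx_mul_vtx_of_ne fun e => h (Prod.ext e.1 e.2)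
  vtx_mul_arr x y e := by
    obtain ⟨a, rfl, rfl⟩ := e
    obtain ⟨b, g, rfl⟩ : ∃ b g, a = coverArrow W hW b g := ⟨_, _, (coverArrow_baseArrow W hW a).symm⟩
    rw [baseArrow_coverArrow, source_coverArrow]
    exact CoveringQuiver.vtx_mul_arr _ _
  arr_mul_vtx x y e := by
    obtain ⟨a, rfl, rfl⟩ := e
    obtain ⟨b, g, rfl⟩ : ∃ b g, a = coverArrow W hW b g := ⟨_, _, (coverArrow_baseArrow W hW a).symm⟩
    rw [baseArrow_coverArrow, target_coverArrow]
    exact CoveringQuiver.arr_mul_vtx _ _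

/-- The homomorphism from the path algebra of the quiver of the covering graph to the path algebra
of the covering quiver. -/
noncomputable def toCovering (K : Type v) [Field K] : PathAlgebra K (Γ.cover W hW).QuiverVertex →ₐ[K]
    PathAlgebra K (CoveringQuiver (arrowWeight W)) :=
  (toCoveringData W hW K).lift K

/-- The data of the homomorphism `ofCovering`. -/
noncomputable def ofCoveringData (K : Type v) [Field K] :
    PathAlgebra.LiftData (CoveringQuiver (arrowWeight W))
      (PathAlgebra K (Γ.cover W hW).QuiverVertex) where
  vtx x := idem (Γ := Γ.cover W hW) K ((x.1 : Γ.E), x.2)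
  arr x y e := (coverArrow W hW e.1.1 x.2).elt K
  sum_vtx := PathAlgebra.sum_vtx (V := (Γ.cover W hW).QuiverVertex)
  idem x := PathAlgebra.vtx_mul_self (V := (Γ.cover W hW).QuiverVertex) _
  orth x y h := PathAlgebra.vtx_mul_vtx_of_ne (V := (Γ.cover W hW).QuiverVertex)
    fun e => h (Prod.ext (congrArg Prod.fst e) (congrArg Prod.snd e))
  vtx_mul_arr x y e := by
    obtain ⟨⟨a, ha, ha'⟩, he⟩ := e
    have h := idem_mul_elt (K := K) (coverArrow W hW a x.2)
    rw [source_coverArrow, ha] at h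
    exact h
  arr_mul_vtx x y e := by
    have h := elt_mul_idem (K := K) (coverArrow W hW e.1.1 x.2)
    have h1 : arrowWeight W e.1.1.hom = arrowWeight W e.1 := weight_hom (arrowWeight W) e.1
    have h2 : y.2 = x.2 * arrowWeight W e.1 := e.2
    rw [target_coverArrow, h1, ← h2, e.1.2.2] at h
    exact h

/-- The homomorphism from the path algebra of the covering quiver to the path algebra of the quiver
of the covering graph. -/
noncomputable def ofCovering (K : Type v) [Field K] :
    PathAlgebra K (CoveringQuiver (arrowWeight W)) →ₐ[K] PathAlgebra K (Γ.cover W hW).QuiverVertex :=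
  (ofCoveringData W hW K).lift K

theorem toCovering_idem (i : Γ.E) (g : G) :
    toCovering W hW K (idem (Γ := Γ.cover W hW) K (i, g))
      = CoveringQuiver.vtx (V := Γ.QuiverVertex) K (arrowWeight W) i g :=
  PathAlgebra.LiftData.lift_vtx (toCoveringData W hW K) _

theorem toCovering_elt (a : (Γ.cover W hW).Arrow) :
    toCovering W hW K (a.elt K) = coveringArr W K (baseArrow W hW a) :=
  PathAlgebra.LiftData.lift_arr (toCoveringData W hW K) _

theorem ofCovering_vtx (i : Γ.E) (g : G) :
    ofCovering W hW K (CoveringQuiver.vtx (V := Γ.QuiverVertex) K (arrowWeight W) i g)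
      = idem (Γ := Γ.cover W hW) K (i, g) :=
  PathAlgebra.LiftData.lift_vtx (ofCoveringData W hW K) _

theorem ofCovering_arr (a : Γ.Arrow) (g : G) :
    ofCovering W hW K (coveringArr W K (a, g)) = (coverArrow W hW a g).elt K :=
  PathAlgebra.LiftData.lift_arr (ofCoveringData W hW K)
    (CoveringQuiver.liftArrow (arrowWeight W) a.hom g)

theorem ofCovering_toCovering (y : PathAlgebra K (Γ.cover W hW).QuiverVertex) :
    ofCovering W hW K (toCovering W hW K y) = y := by
  have h : (ofCovering W hW K).comp (toCovering W hW K) = AlgHom.id K _ := by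
    refine PathAlgebra.algHom_ext (fun x => ?_) fun x y e => ?_
    · exact (congrArg _ (toCovering_idem W hW _ _)).trans (ofCovering_vtx W hW _ _)
    · rw [arr_eq_elt]
      exact (congrArg _ (toCovering_elt W hW _)).trans ((ofCovering_arr W hW _ _).trans
        (congrArg (Arrow.elt K) (coverArrow_baseArrow W hW e.1)))
  exact DFunLike.congr_fun h y

theorem toCovering_ofCovering (y : PathAlgebra K (CoveringQuiver (arrowWeight W))) :
    toCovering W hW K (ofCovering W hW K y) = y := by
  have h : (toCovering W hW K).comp (ofCovering W hW K) = AlgHom.id K _ := by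
    refine PathAlgebra.algHom_ext (fun x => ?_) fun x y e => ?_
    · exact (congrArg _ (ofCovering_vtx W hW _ _)).trans (toCovering_idem W hW _ _)
    · have e1 : PathAlgebra.arr K e = coveringArr W K (e.1.1, x.2) :=
        (CoveringQuiver.arr_eq e).trans (coveringArr_eq W e.1 x.2)
      refine (congrArg _ e1).trans (Eq.trans ?_ e1.symm)
      refine (congrArg (toCovering W hW K) (ofCovering_arr W hW e.1.1 x.2)).trans ?_
      rw [toCovering_elt, baseArrow_coverArrow]
  exact DFunLike.congr_fun h y

/-- The walks of the covering graph are the lifts of the walks of the graph. -/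
theorem toCovering_walk (h : Γ.NonTrunc) (g : G) (n : ℕ) :
    toCovering W hW K (idem (Γ := Γ.cover W hW) K (Γ.edge h, g) * walk K (coverNT W hW h g) n)
      = CoveringQuiver.vtx (V := Γ.QuiverVertex) K (arrowWeight W) (Γ.edge h) g *
          CoveringQuiver.liftHom K (arrowWeight W) (walk K h n) := by
  induction n generalizing h g with
  | zero => rw [walk_zero, walk_zero, mul_one, map_one, mul_one, toCovering_idem]
  | succ n ih =>
    have e1 : toCovering W hW K ((Arrow.ofSucc (coverNT W hW h g)).elt K)
        = CoveringQuiver.vtx (V := Γ.QuiverVertex) K (arrowWeight W) (Γ.edge h) g *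
          CoveringQuiver.liftHom K (arrowWeight W) ((Arrow.ofSucc h).elt K) :=
      (toCovering_elt W hW _).trans (CoveringQuiver.vtx_mul_liftHom_arr (Arrow.ofSucc h).hom g).symm
    have e2 : (Arrow.ofSucc (coverNT W hW h g)).elt K = (Arrow.ofSucc (coverNT W hW h g)).elt K *
        idem (Γ := Γ.cover W hW) K (Γ.edge (Γ.next h).1, g * W h.1) :=
      (elt_mul_idem (K := K) (Arrow.ofSucc (coverNT W hW h g))).symm
    have e3 : idem (Γ := Γ.cover W hW) K (Γ.edge h, g) * (Arrow.ofSucc (coverNT W hW h g)).elt K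
        = (Arrow.ofSucc (coverNT W hW h g)).elt K :=
      idem_mul_elt (K := K) (Arrow.ofSucc (coverNT W hW h g))
    have e4 := ih (Γ.next h) (g * W h.1)
    have e5 : CoveringQuiver.vtx (V := Γ.QuiverVertex) K (arrowWeight W) (Γ.edge h) g *
          CoveringQuiver.liftHom K (arrowWeight W) ((Arrow.ofSucc h).elt K) *
          CoveringQuiver.vtx (V := Γ.QuiverVertex) K (arrowWeight W) (Γ.edge (Γ.next h).1) (g * W h.1)
        = CoveringQuiver.vtx (V := Γ.QuiverVertex) K (arrowWeight W) (Γ.edge h) g *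
          CoveringQuiver.liftHom K (arrowWeight W) ((Arrow.ofSucc h).elt K) := by
      rw [← e1, ← toCovering_idem W hW, ← map_mul, ← e2]
    rw [walk_succ', ← mul_assoc, e3, e2, mul_assoc, map_mul, e1]
    refine (congrArg (_ * ·) e4).trans ?_
    rw [← mul_assoc, e5, mul_assoc, ← map_mul, ← walk_succ']

theorem toCovering_walk_of_ne_zero (h : Γ.NonTrunc) (g : G) {n : ℕ} (hn : n ≠ 0) :
    toCovering W hW K (walk K (coverNT W hW h g) n)
      = CoveringQuiver.vtx (V := Γ.QuiverVertex) K (arrowWeight W) (Γ.edge h) g *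
          CoveringQuiver.liftHom K (arrowWeight W) (walk K h n) := by
  rw [← toCovering_walk W hW, ← idem_mul_walk (coverNT W hW h g) hn]
  rw [← mul_assoc]
  exact congrArg (fun t => toCovering W hW K (t * _))
    (PathAlgebra.vtx_mul_self (V := (Γ.cover W hW).QuiverVertex) _).symm

end BrauerGraph

/-! ### Lifting the relations -/

namespace BrauerGraph

variable {Γ : BrauerGraph.{u}} {K : Type v} [Field K] {G : Type w} [CommGroup G] [Fintype G]
  (W : Γ.SuccessorWeighting G) (hW : IsBrauerWeighting W)

theorem cycle_pow_mul_elt (h : Γ.NonTrunc) :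
    Γ.cycle K h ^ Γ.mult (Γ.vert h) * (Arrow.ofSucc h).elt K = walk K h (len h.1 + 1) := by
  rw [cycle_pow_mult, walk_succ, next_iterate_len]

theorem toCovering_walk_base (k : (Γ.cover W hW).NonTrunc) {n : ℕ} (hn : n ≠ 0) :
    toCovering W hW K (walk K k n)
      = CoveringQuiver.vtx (V := Γ.QuiverVertex) K (arrowWeight W) (Γ.edge k.1.1) k.1.2 *
          CoveringQuiver.liftHom K (arrowWeight W) (walk K (baseNT W hW k) n) :=
  toCovering_walk_of_ne_zero W hW (baseNT W hW k) k.1.2 hn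

theorem toCovering_cycle_pow (k : (Γ.cover W hW).NonTrunc) :
    toCovering W hW K ((Γ.cover W hW).cycle K k ^ (Γ.cover W hW).mult ((Γ.cover W hW).vert k))
      = CoveringQuiver.vtx (V := Γ.QuiverVertex) K (arrowWeight W) (Γ.edge k.1.1) k.1.2 *
          CoveringQuiver.liftHom K (arrowWeight W)
            (Γ.cycle K (baseNT W hW k) ^ Γ.mult (Γ.vert (baseNT W hW k))) := by
  have hl : len k.1 = len (baseNT W hW k).1 := len_cover W hW k.1.1 k.1.2
  rw [cycle_pow_mult, cycle_pow_mult, hl]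
  exact toCovering_walk_base W hW k (len_pos _).ne'

theorem toCovering_cycle_pow_mul_elt (k : (Γ.cover W hW).NonTrunc) :
    toCovering W hW K ((Γ.cover W hW).cycle K k ^ (Γ.cover W hW).mult ((Γ.cover W hW).vert k) *
        (Arrow.ofSucc k).elt K)
      = CoveringQuiver.vtx (V := Γ.QuiverVertex) K (arrowWeight W) (Γ.edge k.1.1) k.1.2 *
          CoveringQuiver.liftHom K (arrowWeight W)
            (Γ.cycle K (baseNT W hW k) ^ Γ.mult (Γ.vert (baseNT W hW k)) *
              (Arrow.ofSucc (baseNT W hW k)).elt K) := by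
  have hl : len k.1 = len (baseNT W hW k).1 := len_cover W hW k.1.1 k.1.2
  rw [cycle_pow_mul_elt, cycle_pow_mul_elt, hl]
  exact toCovering_walk_base W hW k (Nat.succ_ne_zero _)

theorem coveringArr_mul_coveringArr {a b : Γ.Arrow} (hab : a.target = b.source) (g : G) :
    coveringArr W K (a, g) * coveringArr W K (b, g * arrowWeight W a.hom)
      = CoveringQuiver.vtx (V := Γ.QuiverVertex) K (arrowWeight W) a.source g *
          CoveringQuiver.liftHom K (arrowWeight W) (a.elt K * b.elt K) := by
  have h1 : ∀ (c : Γ.Arrow) (g' : G), CoveringQuiver.vtx K (arrowWeight W) c.src g' *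
      CoveringQuiver.liftHom K (arrowWeight W) (c.elt K) = coveringArr W K (c, g') := fun c g' =>
    CoveringQuiver.vtx_mul_liftHom_arr c.hom g'
  have h2 : coveringArr W K (a, g) *
      CoveringQuiver.vtx K (arrowWeight W) a.tgt (g * arrowWeight W a.hom)
        = coveringArr W K (a, g) := CoveringQuiver.arr_mul_vtx a.hom g
  have h3 : a.tgt = b.src := hab
  rw [map_mul, ← mul_assoc]
  refine Eq.trans ?_ (congrArg (· * _) (h1 a g).symm)
  rw [← h2]
  generalize g * arrowWeight W a.hom = g'
  rw [h3, mul_assoc, mul_assoc, h1]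
  exact congrArg _ (CoveringQuiver.vtx_mul_arr b.hom g')

theorem toCovering_sub_smul {y z : PathAlgebra K (Γ.cover W hW).QuiverVertex}
    {y' z' : PathAlgebra K Γ.QuiverVertex} {i : Γ.QuiverVertex} {g : G}
    (hy : toCovering W hW K y = CoveringQuiver.vtx K (arrowWeight W) i g *
      CoveringQuiver.liftHom K (arrowWeight W) y')
    (hz : toCovering W hW K z = CoveringQuiver.vtx K (arrowWeight W) i g *
      CoveringQuiver.liftHom K (arrowWeight W) z') (a b : K) :
    toCovering W hW K (a • y - b • z) = CoveringQuiver.vtx K (arrowWeight W) i g *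
      CoveringQuiver.liftHom K (arrowWeight W) (a • y' - b • z') := by
  rw [map_sub, map_smul, map_smul, map_sub, map_smul, map_smul, mul_sub, mul_smul_comm,
    mul_smul_comm, hy, hz]

theorem toCovering_elt_mul_elt {a b : (Γ.cover W hW).Arrow} {a' b' : Γ.Arrow} {g : G}
    (ha : baseArrow W hW a = (a', g)) (hb : baseArrow W hW b = (b', g * arrowWeight W a'.hom))
    (hab : a'.target = b'.source) :
    toCovering W hW K (a.elt K * b.elt K)
      = CoveringQuiver.vtx (V := Γ.QuiverVertex) K (arrowWeight W) a'.source g *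
          CoveringQuiver.liftHom K (arrowWeight W) (a'.elt K * b'.elt K) := by
  rw [map_mul, toCovering_elt, toCovering_elt, ha, hb]
  exact coveringArr_mul_coveringArr W hab g

theorem toCovering_loop_sq {a : (Γ.cover W hW).Arrow} {i : Γ.E}
    {hi : ∀ h, Γ.edge h = i → Γ.IsTruncated h} {g : G}
    (ha : baseArrow W hW a = (.loop i hi, g)) :
    toCovering W hW K (a.elt K ^ 2)
      = CoveringQuiver.vtx (V := Γ.QuiverVertex) K (arrowWeight W) i g *
          CoveringQuiver.liftHom K (arrowWeight W) ((Arrow.loop i hi).elt K ^ 2) := by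
  rw [pow_two, pow_two]
  have hb : baseArrow W hW a = (.loop i hi, g * arrowWeight W (Arrow.loop i hi).hom) :=
    ha.trans (Prod.ext rfl (mul_one g).symm)
  exact toCovering_elt_mul_elt (a' := .loop i hi) (b' := .loop i hi) W hW ha hb rfl

end BrauerGraph

namespace QuantizedBrauerGraph

open BrauerGraph

variable {K : Type v} [Field K] {G : Type w} [CommGroup G] [Fintype G]
  {Δ : QuantizedBrauerGraph.{u, v} K} {W : Δ.SuccessorWeighting G} {hW : IsBrauerWeighting W}

/-- The relations of the covering graph are lifts of relations of the graph. -/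
theorem exists_relation_of_cover {y : PathAlgebra K (Δ.cover W hW).QuiverVertex}
    (hy : (Δ.cover W hW).Relation y) : ∃ r i g, Δ.Relation r ∧
      toCovering W hW K y = CoveringQuiver.vtx (V := Δ.QuiverVertex) K (arrowWeight W) i g *
        CoveringQuiver.liftHom K (arrowWeight W) r := by
  cases hy with
  | one h hμ hν =>
    have hμ' : ¬ Δ.IsTruncated h.1 := (baseNT W hW ⟨h, hμ⟩).2
    have hν' : ¬ Δ.IsTruncated (Δ.opp h.1) := (baseNT W hW ⟨_, hν⟩).2
    refine ⟨_, Δ.edge h.1, h.2, .one h.1 hμ' hν', ?_⟩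
    have e1 := toCovering_cycle_pow (K := K) W hW ⟨h, hμ⟩
    have e2 := toCovering_cycle_pow (K := K) W hW ⟨_, hν⟩
    have e3 : Δ.edge (Δ.opp h.1) = Δ.edge h.1 := edge_opp h.1
    refine toCovering_sub_smul W hW e1 (e2.trans ?_) _ _
    exact congrArg (fun t => CoveringQuiver.vtx (V := Δ.QuiverVertex) K (arrowWeight W) t h.2 * _) e3
  | two h hμ =>
    have hμ' : Δ.IsTruncated (Δ.opp h.1.1) := (isTruncated_cover_iff W hW _ _).1 hμ
    exact ⟨_, _, _, .two (baseNT W hW h) hμ', toCovering_cycle_pow_mul_elt W hW h⟩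
  | three h k hk hne =>
    have hk1 : Δ.edge (Δ.succ h.1.1) = Δ.edge k.1.1 := congrArg Prod.fst hk
    have hk2 : h.1.2 * W h.1.1 = k.1.2 := congrArg Prod.snd hk
    refine ⟨_, Δ.edge h.1.1, h.1.2, .three (baseNT W hW h) (baseNT W hW k) hk1 fun e => hne ?_, ?_⟩
    · exact Subtype.ext (Prod.ext (congrArg Subtype.val e) hk2.symm)
    · have ha : baseArrow W hW (.ofSucc h) = (.ofSucc (baseNT W hW h), h.1.2) := rfl
      have hb : baseArrow W hW (.ofSucc k) = (.ofSucc (baseNT W hW k),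
          h.1.2 * arrowWeight W (Arrow.ofSucc (baseNT W hW h)).hom) := Prod.ext rfl hk2.symm
      have e := toCovering_elt_mul_elt (K := K) W hW ha hb hk1
      exact e
  | square x hx =>
    have ha : baseArrow W hW (.loop x hx) = (.loop x.1 (loop_base W hW hx), x.2) := rfl
    exact ⟨_, x.1, x.2, .square x.1 (loop_base W hW hx), toCovering_loop_sq (K := K) W hW ha⟩

/-- The lifts of a relation of the graph are relations of the covering graph. -/
theorem exists_relation_cover {r : PathAlgebra K Δ.QuiverVertex} (hr : Δ.Relation r) :
    ∃ i : Δ.E, idem K i * r = r ∧ ∀ g : G, ∃ y, (Δ.cover W hW).Relation y ∧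
      toCovering W hW K y = CoveringQuiver.vtx (V := Δ.QuiverVertex) K (arrowWeight W) i g *
        CoveringQuiver.liftHom K (arrowWeight W) r := by
  cases hr with
  | one h hμ hν =>
    refine ⟨Δ.edge h, ?_, fun g => ?_⟩
    · have e1 := idem_mul_walk (K := K) (⟨h, hμ⟩ : Δ.NonTrunc)
        (n := len h) (len_pos _).ne'
      have e2 := idem_mul_walk (K := K) (⟨Δ.opp h, hν⟩ : Δ.NonTrunc)
        (n := len (Δ.opp h)) (len_pos _).ne'
      rw [edge_opp] at e2
      rw [cycle_pow_mult (⟨h, hμ⟩ : Δ.NonTrunc), cycle_pow_mult (⟨Δ.opp h, hν⟩ : Δ.NonTrunc), mul_sub,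
        mul_smul_comm, mul_smul_comm, e1, e2]
    · refine ⟨_, .one (Γ := Δ.cover W hW) (h, g) (coverNT W hW ⟨h, hμ⟩ g).2
        (coverNT W hW ⟨Δ.opp h, hν⟩ g).2, ?_⟩
      have e1 := toCovering_cycle_pow (K := K) W hW (coverNT W hW ⟨h, hμ⟩ g)
      have e2 := toCovering_cycle_pow (K := K) W hW (coverNT W hW ⟨Δ.opp h, hν⟩ g)
      have e3 : Δ.edge (Δ.opp h) = Δ.edge h := edge_opp h
      refine toCovering_sub_smul W hW e1 (e2.trans ?_) _ _
      exact congrArg (fun t => CoveringQuiver.vtx (V := Δ.QuiverVertex) K (arrowWeight W) t g * _) e3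
  | two h hμ =>
    refine ⟨Δ.edge h, ?_, fun g => ?_⟩
    · rw [cycle_pow_mul_elt]
      exact idem_mul_walk h (Nat.succ_ne_zero _)
    · exact ⟨_, .two (Γ := Δ.cover W hW) (coverNT W hW h g) ((isTruncated_cover_iff W hW _ _).2 hμ),
        toCovering_cycle_pow_mul_elt W hW (coverNT W hW h g)⟩
  | three h k hk hne =>
    refine ⟨Δ.edge h, ?_, fun g => ?_⟩
    · rw [← mul_assoc]
      exact congrArg (· * _) (idem_mul_elt (K := K) (.ofSucc h))
    · refine ⟨_, .three (Γ := Δ.cover W hW) (coverNT W hW h g) (coverNT W hW k (g * W h))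
        (Prod.ext hk rfl) fun e => hne ?_, ?_⟩
      · exact Subtype.ext (congrArg (fun t => t.1.1) e)
      · have ha : baseArrow W hW (.ofSucc (coverNT W hW h g)) = (.ofSucc h, g) := rfl
        have hb : baseArrow W hW (.ofSucc (coverNT W hW k (g * W h))) = (.ofSucc k,
            g * arrowWeight W (Arrow.ofSucc h).hom) := rfl
        have e := toCovering_elt_mul_elt (K := K) W hW ha hb hk
        exact e
  | square i hi =>
    refine ⟨i, ?_, fun g => ?_⟩
    · rw [pow_two, ← mul_assoc]
      exact congrArg (· * _) (idem_mul_elt (K := K) (.loop i hi))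
    · have ha : baseArrow W hW (.loop (i, g) (loop_cover W hW hi g)) = (.loop i hi, g) := rfl
      exact ⟨_, .square (Γ := Δ.cover W hW) (i, g) (loop_cover W hW hi g),
        toCovering_loop_sq (K := K) W hW ha⟩

theorem ofCovering_liftHom_mem_ideal {r : PathAlgebra K Δ.QuiverVertex} (hr : Δ.Relation r) :
    ofCovering W hW K (CoveringQuiver.liftHom K (arrowWeight W) r) ∈ (Δ.cover W hW).ideal := by
  obtain ⟨i, hi, hg⟩ := exists_relation_cover (W := W) (hW := hW) hr
  have hdec : CoveringQuiver.liftHom K (arrowWeight W) r = ∑ j : Δ.QuiverVertex, ∑ g : G,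
      CoveringQuiver.vtx K (arrowWeight W) j g * CoveringQuiver.liftHom K (arrowWeight W) r := by
    simp only [← Finset.sum_mul, CoveringQuiver.sum_vtx, one_mul]
  rw [hdec, map_sum]
  refine sum_mem fun j _ => ?_
  rw [map_sum]
  refine sum_mem fun g _ => ?_
  by_cases hj : j = i
  · obtain ⟨y, hy, he⟩ := hg g
    rw [hj]
    refine (congrArg (· ∈ (Δ.cover W hW).ideal) (congrArg _ he)).mp ?_
    exact (congrArg (· ∈ (Δ.cover W hW).ideal) (ofCovering_toCovering W hW y)).mpr
      (TwoSidedIdeal.subset_span hy)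
  · have h0 : CoveringQuiver.vtx K (arrowWeight W) j g *
        CoveringQuiver.liftHom K (arrowWeight W) (idem K i) = 0 :=
      CoveringQuiver.vtx_mul_liftHom_vtx_of_ne hj g
    have hz : CoveringQuiver.vtx K (arrowWeight W) j g *
        CoveringQuiver.liftHom K (arrowWeight W) r = 0 := by
      rw [← hi, map_mul, ← mul_assoc, h0, zero_mul]
    rw [hz, map_zero]
    exact zero_mem _

/-- The covering algebra of a Brauer weighting is the algebra of the covering graph. -/
theorem nonempty_coveringAlgebra_algEquiv (Δ : QuantizedBrauerGraph.{u, v} K)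
    (W : Δ.SuccessorWeighting G) (hW : IsBrauerWeighting W) :
    Nonempty (CoveringAlgebra (arrowWeight W) Δ.ideal ≃ₐ[K] (Δ.cover W hW).Alg) := by
  refine ⟨TwoSidedIdeal.quotientEquiv (CoveringQuiver.ideal (arrowWeight W) Δ.ideal)
    (Δ.cover W hW).ideal (ofCovering W hW K) (toCovering W hW K) (fun x hx => ?_) (fun x hx => ?_)
    (toCovering_ofCovering W hW) (ofCovering_toCovering W hW)⟩
  · rw [← toAlg_eq_zero_iff]
    refine TwoSidedIdeal.apply_eq_zero_of_mem_span
      (((Δ.cover W hW).toAlg).comp (ofCovering W hW K)) ?_ hx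
    rintro _ ⟨a, b, f, rfl, hf⟩
    rw [← CoveringQuiver.vtx_mul_liftHom_mul_vtx, map_mul, map_mul]
    have h0 := TwoSidedIdeal.apply_eq_zero_of_mem_span ((((Δ.cover W hW).toAlg).comp
      (ofCovering W hW K)).comp (CoveringQuiver.liftHom K (arrowWeight W)))
      (fun r hr => (toAlg_eq_zero_iff _ _).2 (ofCovering_liftHom_mem_ideal hr)) hf
    exact (congrArg (_ * · * _) h0).trans (by rw [mul_zero, zero_mul])
  · rw [← TwoSidedIdeal.mkAlg_eq_zero_iff (K := K)]
    refine TwoSidedIdeal.apply_eq_zero_of_mem_span ((TwoSidedIdeal.mkAlg K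
      (CoveringQuiver.ideal (arrowWeight W) Δ.ideal)).comp
      (toCovering W hW K)) (fun y hy => 
      (TwoSidedIdeal.mkAlg_eq_zero_iff (K := K) _ _).2 ?_) hx
    obtain ⟨r, i, g, hr, he⟩ := exists_relation_of_cover hy
    obtain ⟨γ, hγ⟩ := exists_hasWeight_of_relation (cyclePowWeight_eq_one hW) hr
    exact he ▸ TwoSidedIdeal.mul_mem_left _ _ _
      (CoveringQuiver.liftHom_mem_ideal (TwoSidedIdeal.subset_span hr) hγ)

end QuantizedBrauerGraph

/-! ### Weight functions induced by Brauer weightings -/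

namespace BrauerGraph

variable {G : Type w} [CommGroup G] {Δ : BrauerGraph.{u}}

open Classical in
/-- The successor weighting given by a weight function, with the value `1` at the half-edges that
are truncated. -/
noncomputable def successorWeighting (Δ : BrauerGraph.{u}) (ω : WeightFunction Δ.QuiverVertex G) :
    Δ.SuccessorWeighting G :=
  fun h => if ht : Δ.IsTruncated h then 1 else ω (Arrow.ofSucc ⟨h, ht⟩).hom

theorem arrowWeight_successorWeighting {ω : WeightFunction Δ.QuiverVertex G}
    (hω : ∀ (i : Δ.E) (hi : ∀ h, Δ.edge h = i → Δ.IsTruncated h), ω (Arrow.loop i hi).hom = 1) :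
    arrowWeight (successorWeighting Δ ω) = ω := by
  funext i j e
  obtain ⟨a, rfl, rfl⟩ := e
  cases a with
  | ofSucc h => exact dif_neg h.2
  | loop i hi => exact (hω i hi).symm

theorem isBrauerWeighting_successorWeighting
    {ω : WeightFunction Δ.QuiverVertex G}
    (hω : ∀ (i : Δ.E) (hi : ∀ h, Δ.edge h = i → Δ.IsTruncated h), ω (Arrow.loop i hi).hom = 1)
    (h1 : ∀ h : Δ.NonTrunc, ¬ Δ.IsTruncated (Δ.opp h) → Δ.cyclePowWeight ω h = 1)
    (h2 : ∀ h : Δ.NonTrunc, (∀ k, Δ.vert k = Δ.vert h → Δ.IsTruncated (Δ.opp k)) →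
      Δ.cyclePowWeight ω h = 1) : IsBrauerWeighting (successorWeighting Δ ω) := by
  intro μ
  obtain ⟨h, rfl⟩ := Δ.vert_surjective μ
  rw [orderOf_dvd_iff_pow_eq_one]
  by_cases ht : Δ.IsTruncated h
  · rw [← prod_range_val, ht.1, ht.2]
    simp [successorWeighting, ht]
  · have key : ∀ k : Δ.NonTrunc, Δ.vert k = Δ.vert h → Δ.cyclePowWeight ω k = 1 →
        vertexWeight (successorWeighting Δ ω) (Δ.vert h) ^ Δ.mult (Δ.vert h) = 1 := by
      intro k hk hk1
      rwa [← hk, ← cyclePowWeight_arrowWeight, arrowWeight_successorWeighting hω]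
    by_cases hall : ∀ k, Δ.vert k = Δ.vert h → Δ.IsTruncated (Δ.opp k)
    · exact key ⟨h, ht⟩ rfl (h2 ⟨h, ht⟩ hall)
    · push Not at hall
      obtain ⟨k, hk, hko⟩ := hall
      have hkt : ¬ Δ.IsTruncated k := by rwa [IsTruncated, hk]
      exact key ⟨k, hkt⟩ hk (h1 ⟨k, hkt⟩ hko)

end BrauerGraph

/-! ### Coverings of Brauer graph algebras -/

theorem mainTheorem2 {K : Type v} [Field K] {G : Type w} [CommGroup G] [Fintype G]
    (Δ : QuantizedBrauerGraph.{u, v} K) :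
    -- (1)
    (∀ (W : Δ.SuccessorWeighting G) (hW : BrauerGraph.IsBrauerWeighting W),
      IsGeneratedByHomogeneous (BrauerGraph.arrowWeight W) Δ.ideal ∧
      Nonempty (CoveringAlgebra (BrauerGraph.arrowWeight W) Δ.ideal ≃ₐ[K] (Δ.cover W hW).Alg) ∧
      ∀ h : Δ.NonTrunc, Δ.cyclePowWeight (BrauerGraph.arrowWeight W) h = 1) ∧
    -- (2)
    (∀ ω : WeightFunction Δ.QuiverVertex G,
      IsGeneratedByHomogeneous ω Δ.ideal →
      (∀ h : Δ.NonTrunc, ¬ Δ.IsTruncated (Δ.opp h) → Δ.cyclePowWeight ω h = 1) →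
      (∀ h : Δ.NonTrunc, (∀ k, Δ.vert k = Δ.vert h → Δ.IsTruncated (Δ.opp k)) →
        Δ.cyclePowWeight ω h = 1) →
      (∀ (i : Δ.E) (hi : ∀ h, Δ.edge h = i → Δ.IsTruncated h),
        ω (BrauerGraph.Arrow.loop i hi).hom = 1) →
      ∃ (W : Δ.SuccessorWeighting G) (hW : BrauerGraph.IsBrauerWeighting W),
        BrauerGraph.arrowWeight W = ω ∧
        Nonempty (CoveringAlgebra ω Δ.ideal ≃ₐ[K] (Δ.cover W hW).Alg)) ∧
    -- (3)
    (∀ ω : WeightFunction Δ.QuiverVertex G,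
      IsGeneratedByHomogeneous ω Δ.ideal →
      (∃ h : Δ.NonTrunc, Δ.cyclePowWeight ω h ≠ 1) →
      ∀ Γ : QuantizedBrauerGraph.{x, v} K,
        IsEmpty (CoveringAlgebra ω Δ.ideal ≃ₐ[K] Γ.Alg)) := by
  refine ⟨fun W hW => ?_, fun ω _ h1 h2 h3 => ?_, fun ω _ hω Γ => ?_⟩
  · have h1 := BrauerGraph.cyclePowWeight_eq_one hW
    exact ⟨QuantizedBrauerGraph.isGeneratedByHomogeneous h1,
      Δ.nonempty_coveringAlgebra_algEquiv W hW, h1⟩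
  · have hW := BrauerGraph.isBrauerWeighting_successorWeighting h3 h1 h2
    have he := BrauerGraph.arrowWeight_successorWeighting h3
    refine ⟨_, hW, he, ?_⟩
    have := Δ.nonempty_coveringAlgebra_algEquiv _ hW
    rwa [he] at this
  · obtain ⟨h, hw⟩ := hω
    exact Δ.isEmpty_coveringAlgebra_algEquiv ω hw Γ
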